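/- \textbf{Setting.} Let $\mathcal A$ be a finite alphabet with the discrete topology and $(T\omega)(n)=\omega(n+1)$ the shift on $\mathcal A^{\mathbb Z}$. A subshift is a closed set $\Omega\subseteq\mathcal A^{\mathbb Z}$ with $T\Omega=\Omega$; $\mathcal W(\Omega)_n$ is the set of words of length $n$ occurring in elements of $\Omega$. A map $A$ on $\Omega$ is locally constant if for some $N$ the value $A(\omega)$ depends only on $\omega(-N)\dots\omega(N)$. A map $A:\Omega\to SL(2,\mathbb R)$ generates the cocycle $A(n,\omega)=A(T^{n-1}\omega)\cdots A(\omega)$ for $n>0$, $A(0,\omega)=\mathrm{Id}$, $A(n,\omega)=A(T^{n}\omega)^{-1}\cdots A(T^{-1}\omega)^{-1}$ for $n<0$. It is uniform if, for some $\Lambda\in\mathbb R$, $\frac1n\log\|A(n,\omega)\|\to\Lambda$ as $n\to\infty$, uniformly in $\omega\in\Omega$ (with the Euclidean operator norm). \textbf{(LSC).} $\Omega$ satisfies the leading sequence condition (LSC) if there are $r\ge 1$ and $\omega^{(1)},\dots,\omega^{(r)}\in\Omega$ such that ($\alpha$) for all sufficiently large $n$, $\mathcal W(\Omega)_n=\bigcup_{j=1}^r\{\omega^{(j)}(-k+1)\dots\omega^{(j)}(-k+n):k=0,\dots,n\}$;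 and, for every locally constant $A:\Omega\to SL(2,\mathbb R)$, ($\beta$) the limits $\lim_{n\to\pm\infty}\frac1{|n|}\log\|A(n,\omega^{(j)})\|$, $j=1,\dots,r$, all exist and have the same value; ($\gamma$) for every $j$ and every $v\in\mathbb R^2\setminus\{0\}$ the two limits $\lim_{n\to\pm\infty}\frac1{|n|}\log\|A(n,\omega^{(j)})v\|$ exist and at most one of them is negative. \textbf{Simple Toeplitz subshifts.} Let $(a_k)_{k\ge0}$ in $\mathcal A$ and $(n_k)_{k\ge0}$ in $\{2,3,\dots\}$ be sequences such that $a_{k+1}\ne a_k$ for all $k$ and at least two letters occur infinitely often in $(a_k)$. Put $p^{(-1)}=\epsilon$ (the empty word) and $p^{(k+1)}=p^{(k)}a_{k+1}p^{(k)}\dots p^{(k)}a_{k+1}p^{(k)}$ with $n_{k+1}$ copies of $p^{(k)}$ and $n_{k+1}-1$ letters $a_{k+1}$, and let $p^{(\infty)}=\lim_k p^{(k)}$. The simple Toeplitz subshift with coding sequences $(a_k),(n_k)$ is the set $\Omega$ of all $\omega\in\mathcal A^{\mathbb Z}$ all of whose finite words occur in $p^{(\infty)}$. \textbf{Theorem.}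 Every simple Toeplitz subshift satisfies (LSC), and every locally constant $A:\Omega\to SL(2,\mathbb R)$ over a simple Toeplitz subshift $\Omega$ is uniform. Moreover, there is a simple Toeplitz subshift over a finite alphabet that does not satisfy the Boshernitzan condition, and over which therefore all locally constant cocycles are uniform although that condition fails. Here $\Omega$ satisfies the Boshernitzan condition if there is an ergodic $T$-invariant probability measure $\mu$ on $\Omega$ with $\limsup_{n\to\infty} n\cdot\min\{\mu(\{\omega\in\Omega:\omega(0)\dots\omega(n-1)=w\}): w\in\mathcal W(\Omega)_n\}>0$. -/

import Mathlib

open Filter Topology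
open scoped ENNReal

/-! ## Words and subshifts -/

/-- The shift `(T ω)(n) = ω (n + 1)` on two-sided sequences, as a bijection. -/
def shift (A : Type*) : Equiv.Perm (ℤ → A) where
  toFun ω := fun n => ω (n + 1)
  invFun ω := fun n => ω (n - 1)
  left_inv ω := by funext n; simp
  right_inv ω := by funext n; simp

/-- The finite word `ω(k) ω(k+1) … ω(k+n-1)` of length `n`. -/
def wordAt {A : Type*} (ω : ℤ → A) (k : ℤ) (n : ℕ) : List A :=
  List.ofFn fun i : Fin n => ω (k + (i : ℕ))

/-- A subshift over `A`: a closed shift-invariant set of two-sided sequences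
(`A` carries the discrete topology wherever this is used). -/
structure Subshift (A : Type*) [TopologicalSpace A] where
  carrier : Set (ℤ → A)
  isClosed : IsClosed carrier
  shift_mem_iff : ∀ ω, shift A ω ∈ carrier ↔ ω ∈ carrier

namespace Subshift

variable {A : Type*} [TopologicalSpace A]

/-- The shift restricted to the subshift. -/
def T (Ω : Subshift A) : Equiv.Perm Ω.carrier :=
  (shift A).subtypePerm Ω.shift_mem_iff

/-- The words of length `n` that occur in some element of the subshift. -/
def words (Ω : Subshift A) (n : ℕ) : Set (List A) :=
  {w | ∃ ω ∈ Ω.carrier, ∃ k : ℤ, w = wordAt ω k n}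

/-- A function on the subshift is locally constant if `f ω` depends only on
`ω(-N) … ω(N)` for some `N`. -/
def IsLocConst (Ω : Subshift A) {Y : Type*} (f : Ω.carrier → Y) : Prop :=
  ∃ N : ℕ, ∀ ω ρ : Ω.carrier,
    (∀ i : ℤ, -(N : ℤ) ≤ i → i ≤ N → ω.1 i = ρ.1 i) → f ω = f ρ

end Subshift

/-! ## Cocycles -/

/-- `M(T^{n-1} x) ⋯ M(x)`. -/
def cocycleForward {X : Type*} (T : Equiv.Perm X)
    (M : X → Matrix.SpecialLinearGroup (Fin 2) ℝ) :
    ℕ → X → Matrix.SpecialLinearGroup (Fin 2) ℝ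
  | 0, _ => 1
  | n + 1, x => M ((T ^ n) x) * cocycleForward T M n x

/-- `M(T^{-n} x)⁻¹ ⋯ M(T^{-1} x)⁻¹`. -/
def cocycleBackward {X : Type*} (T : Equiv.Perm X)
    (M : X → Matrix.SpecialLinearGroup (Fin 2) ℝ) :
    ℕ → X → Matrix.SpecialLinearGroup (Fin 2) ℝ
  | 0, _ => 1
  | n + 1, x => (M ((T⁻¹ ^ (n + 1)) x))⁻¹ * cocycleBackward T M n x

/-- The cocycle `M(n, x)`, `n ∈ ℤ`, generated by `M` over `T`. -/
def cocycle {X : Type*} (T : Equiv.Perm X)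
    (M : X → Matrix.SpecialLinearGroup (Fin 2) ℝ) (n : ℤ) (x : X) :
    Matrix.SpecialLinearGroup (Fin 2) ℝ :=
  if 0 ≤ n then cocycleForward T M n.toNat x else cocycleBackward T M (-n).toNat x

/-- The linear map of the Euclidean plane given by an element of `SL(2,ℝ)`. -/
noncomputable def slToCLM (B : Matrix.SpecialLinearGroup (Fin 2) ℝ) :
    EuclideanSpace ℝ (Fin 2) →L[ℝ] EuclideanSpace ℝ (Fin 2) :=
  Matrix.toEuclideanCLM (n := Fin 2) (𝕜 := ℝ) (B : Matrix (Fin 2) (Fin 2) ℝ)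

/-- `M` is uniform over `T`: `(1/n) log ‖M(n, x)‖` converges, as `n → ∞`, uniformly in `x` to a
constant (`‖·‖` is the Euclidean operator norm). -/
def IsUniformCocycle {X : Type*} (T : Equiv.Perm X)
    (M : X → Matrix.SpecialLinearGroup (Fin 2) ℝ) : Prop :=
  ∃ Λ : ℝ, TendstoUniformly
    (fun (n : ℕ) (x : X) => Real.log ‖slToCLM (cocycle T M (n : ℤ) x)‖ / (n : ℝ))
    (fun _ => Λ) atTop

/-! ## The leading sequence condition and the Boshernitzan condition -/

namespace Subshift

variable {A : Type*} [TopologicalSpace A]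

/-- Condition (α) for the sequences `ω⁽ʲ⁾`: all sufficiently long words of the subshift are
exactly the words occurring around the origin in one of the `ω⁽ʲ⁾`. -/
def LeadingAlpha (Ω : Subshift A) {r : ℕ} (ω : Fin r → Ω.carrier) : Prop :=
  ∃ N : ℕ, ∀ n : ℕ, N ≤ n →
    Ω.words n = {w | ∃ j : Fin r, ∃ k : ℕ, k ≤ n ∧ w = wordAt (ω j).1 (-(k : ℤ) + 1) n}

/-- Condition (β) for the cocycle generated by `M`: the limits of `log ‖M(n, ω⁽ʲ⁾)‖ / |n|` for
`n → +∞` and `n → -∞` exist for all `j`, and all of them have the same value. -/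
def LeadingBeta (Ω : Subshift A) {r : ℕ} (ω : Fin r → Ω.carrier)
    (M : Ω.carrier → Matrix.SpecialLinearGroup (Fin 2) ℝ) : Prop :=
  ∃ Λ : ℝ, ∀ j : Fin r,
    Tendsto (fun n : ℤ => Real.log ‖slToCLM (cocycle Ω.T M n (ω j))‖ / |(n : ℝ)|)
      atTop (𝓝 Λ) ∧
    Tendsto (fun n : ℤ => Real.log ‖slToCLM (cocycle Ω.T M n (ω j))‖ / |(n : ℝ)|)
      atBot (𝓝 Λ)

/-- Condition (γ) for the cocycle generated by `M`: for all `j` and all `v ≠ 0`, the limits of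
`log ‖M(n, ω⁽ʲ⁾) v‖ / |n|` for `n → +∞` and `n → -∞` exist and at most one of the two is
negative. -/
def LeadingGamma (Ω : Subshift A) {r : ℕ} (ω : Fin r → Ω.carrier)
    (M : Ω.carrier → Matrix.SpecialLinearGroup (Fin 2) ℝ) : Prop :=
  ∀ (j : Fin r) (v : EuclideanSpace ℝ (Fin 2)), v ≠ 0 →
    ∃ Lp Lm : ℝ,
      Tendsto (fun n : ℤ => Real.log ‖slToCLM (cocycle Ω.T M n (ω j)) v‖ / |(n : ℝ)|)
        atTop (𝓝 Lp) ∧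
      Tendsto (fun n : ℤ => Real.log ‖slToCLM (cocycle Ω.T M n (ω j)) v‖ / |(n : ℝ)|)
        atBot (𝓝 Lm) ∧
      ¬ (Lp < 0 ∧ Lm < 0)

/-- The leading sequence condition (LSC). -/
def LSC (Ω : Subshift A) : Prop :=
  ∃ r : ℕ, 1 ≤ r ∧ ∃ ω : Fin r → Ω.carrier,
    Ω.LeadingAlpha ω ∧
    ∀ M : Ω.carrier → Matrix.SpecialLinearGroup (Fin 2) ℝ, Ω.IsLocConst M →
      Ω.LeadingBeta ω M ∧ Ω.LeadingGamma ω M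

/-- The Boshernitzan condition: there is an ergodic shift-invariant probability measure `μ` on
the subshift with `limsup n · min {μ[w] : w a word of length n} > 0`, where `[w]` is the cylinder
set of `w`. -/
def Boshernitzan [MeasurableSpace A] (Ω : Subshift A) : Prop :=
  ∃ μ : MeasureTheory.Measure Ω.carrier,
    MeasureTheory.IsProbabilityMeasure μ ∧ Ergodic Ω.T μ ∧
    0 < limsup (fun n : ℕ => (n : ℝ≥0∞) *
      ⨅ w ∈ Ω.words n, μ {ω : Ω.carrier | wordAt ω.1 0 n = w}) atTop

end Subshift

/-! ## Simple Toeplitz subshifts -/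

/-- The coding sequences of a simple Toeplitz subshift. -/
structure ToeplitzCoding (A : Type*) where
  /-- the letters `a_k` -/
  a : ℕ → A
  /-- the period lengths `n_k` -/
  n : ℕ → ℕ
  two_le_n : ∀ k, 2 ≤ n k
  a_succ_ne : ∀ k, a (k + 1) ≠ a k
  /-- the eventual alphabet has at least two letters -/
  eventual_nontrivial : {x : A | ∃ᶠ k in atTop, a k = x}.Nontrivial

namespace ToeplitzCoding

variable {A : Type*}

/-- The palindromic blocks: `block 0 = ε` and
`block (k+1) = block k · a_k · block k ⋯ block k · a_k · block k` with `n_k` copies of `block k`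
and `n_k - 1` letters `a_k`. -/
def block (c : ToeplitzCoding A) : ℕ → List A
  | 0 => []
  | k + 1 => block c k ++ (List.replicate (c.n k - 1) (c.a k :: block c k)).flatten

/-- The one-sided infinite word `lim block k`. The default value `a 0` is never used, by
`le_length_block`. -/
def limitWord (c : ToeplitzCoding A) (i : ℕ) : A :=
  ((c.block (i + 1))[i]?).getD (c.a 0)

theorem length_block_succ (c : ToeplitzCoding A) (k : ℕ) :
    (c.block (k + 1)).length + 1 = c.n k * ((c.block k).length + 1) := by
  have h := c.two_le_n k
  obtain ⟨m, hm⟩ : ∃ m, c.n k = m + 1 := ⟨c.n k - 1, by omega⟩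
  simp only [block, List.length_append, List.length_flatten, List.map_replicate,
    List.sum_replicate, List.length_cons, hm, Nat.add_sub_cancel, smul_eq_mul]
  ring

theorem le_length_block (c : ToeplitzCoding A) (k : ℕ) : k ≤ (c.block k).length := by
  induction k with
  | zero => simp
  | succ k ih =>
    have h := c.length_block_succ k
    have h2 := c.two_le_n k
    nlinarith

theorem block_prefix (c : ToeplitzCoding A) {k l : ℕ} (h : k ≤ l) :
    c.block k <+: c.block l := by
  induction l, h using Nat.le_induction with
  | base => exact List.prefix_rfl
  | succ l _ ih => exact ih.trans (List.prefix_append _ _)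

/-- Every block is a prefix of the limit word. -/
theorem limitWord_eq (c : ToeplitzCoding A) (k i : ℕ) (h : i < (c.block k).length) :
    c.limitWord i = (c.block k)[i] := by
  have h1 : i < (c.block (i + 1)).length := c.le_length_block (i + 1)
  unfold limitWord
  rw [List.getElem?_eq_getElem h1, Option.getD_some]
  rcases le_total k (i + 1) with hk | hk
  · exact ((c.block_prefix hk).getElem h).symm
  · exact (c.block_prefix hk).getElem h1

/-- The set of all two-sided sequences all of whose finite words occur in the limit word. -/
def toeplitzSet (c : ToeplitzCoding A) : Set (ℤ → A) :=
  {ω | ∀ (k : ℤ) (n : ℕ), ∃ m : ℕ,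
    wordAt ω k n = List.ofFn fun i : Fin n => c.limitWord (m + i)}

theorem shift_mem_toeplitzSet_iff (c : ToeplitzCoding A) (ω : ℤ → A) :
    shift A ω ∈ c.toeplitzSet ↔ ω ∈ c.toeplitzSet := by
  have key : ∀ k n, wordAt (shift A ω) k n = wordAt ω (k + 1) n := by
    intro k n
    simp only [wordAt, shift, Equiv.coe_fn_mk]
    congr 1
    funext i
    congr 1
    ring
  constructor
  · intro h k n
    have := h (k - 1) n
    rwa [key, sub_add_cancel] at this
  · intro h k n
    rw [key]
    exact h (k + 1) n

theorem isClosed_toeplitzSet [TopologicalSpace A] [DiscreteTopology A] (c : ToeplitzCoding A) :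
    IsClosed c.toeplitzSet := by
  have : c.toeplitzSet = ⋂ (k : ℤ) (n : ℕ),
      (fun (ω : ℤ → A) (i : Fin n) => ω (k + (i : ℕ))) ⁻¹'
        {f | ∃ m : ℕ, f = fun i : Fin n => c.limitWord (m + i)} := by
    ext ω
    simp only [toeplitzSet, wordAt, List.ofFn_inj, Set.mem_ofPred_eq, Set.mem_iInter,
      Set.mem_preimage]
  rw [this]
  refine isClosed_iInter fun k => isClosed_iInter fun n => ?_
  exact (isClosed_discrete _).preimage (by fun_prop)

/-- The simple Toeplitz subshift with the given coding sequences. -/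
def subshift [TopologicalSpace A] [DiscreteTopology A] (c : ToeplitzCoding A) : Subshift A where
  carrier := c.toeplitzSet
  isClosed := c.isClosed_toeplitzSet
  shift_mem_iff := c.shift_mem_toeplitzSet_iff

end ToeplitzCoding

/-! In the limit word, shifted so that its first letter sits at position 1, position `t` carries
`a_j`, where `j` is the largest index such that `period j = n_0 ⋯ n_{j-1}` divides `t`. Reflecting
this and putting at the origin a letter that occurs infinitely often gives finitely many leading
sequences. A long factor looks like one of them around its position of highest level
(`exists_leadingSeq_window`), which is (α).

Logarithmic norms over words are subadditive and, up to a bounded error, depend on the word alone.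
Since `block (k+1)` consists of copies of `block k`, these norms have a growth rate `L` along
blocks; the repetitive structure forces the same rate on all prefixes and on their left-sided
counterparts (`IsWordCost.exists_rate`), which is (β).

If `L > 0`, the most contracted directions of the two half-line products converge exponentially. For
infinitely many `k`, the window of radius `period k` about the origin of a leading sequence is, up
to its first letter, a prefix of the limit word of twice the length, so the product over it grows at
nearly the full rate. Hence the two limiting directions differ
(`HasGrowthRate.exists_le_abs_cross`). This gives (γ), and also a lower bound for every window
around the origin (`HasGrowthRate.exists_log_mul_inv_ge`); by (α) the bound reaches all long words,
whence uniformity.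

For the counterexample, some words of length `n` recur only at distances that are multiples of a
number much larger than `n` (`cyclicCoding_dvd`), so invariance alone makes their measure `o(1/n)`.
-/

/-! ### Arithmetic description of the limit word. -/

namespace ToeplitzCoding

variable {A : Type*}

/-- The products `n_0 ⋯ n_{k-1}`; the holes of the `k`-th periodic skeleton are spaced by
`period k`. -/
def period (c : ToeplitzCoding A) (k : ℕ) : ℕ := ∏ i ∈ Finset.range k, c.n i

theorem period_succ (c : ToeplitzCoding A) (k : ℕ) : c.period (k + 1) = c.period k * c.n k :=
  Finset.prod_range_succ _ _

theorem period_pos (c : ToeplitzCoding A) (k : ℕ) : 0 < c.period k :=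
  Finset.prod_pos fun i _ => by have := c.two_le_n i; omega

theorem period_lt_succ (c : ToeplitzCoding A) (k : ℕ) : c.period k < c.period (k + 1) := by
  rw [period_succ]
  have := c.two_le_n k
  have := c.period_pos k
  nlinarith

theorem period_strictMono (c : ToeplitzCoding A) : StrictMono c.period :=
  strictMono_nat_of_lt_succ c.period_lt_succ

theorem lt_period (c : ToeplitzCoding A) (k : ℕ) : k < c.period k := by
  induction k with
  | zero => exact c.period_pos 0
  | succ k ih => exact lt_of_le_of_lt ih (c.period_lt_succ k)

theorem period_dvd (c : ToeplitzCoding A) {k l : ℕ} (h : k ≤ l) : c.period k ∣ c.period l :=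
  Finset.prod_dvd_prod_of_subset _ _ _ (Finset.range_mono h)

theorem period_dvd_int (c : ToeplitzCoding A) {k l : ℕ} (h : k ≤ l) :
    (c.period k : ℤ) ∣ c.period l :=
  Int.natCast_dvd_natCast.2 (c.period_dvd h)

/-- The skeleton level of a position: the least `j` such that `period (j + 1)` does not divide
it. -/
noncomputable def level (c : ToeplitzCoding A) (t : ℤ) : ℕ :=
  sInf {j | ¬ (c.period (j + 1) : ℤ) ∣ t}

theorem level_eq (c : ToeplitzCoding A) {t : ℤ} {j : ℕ} (h : (c.period j : ℤ) ∣ t)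
    (h' : ¬ (c.period (j + 1) : ℤ) ∣ t) : c.level t = j := by
  apply le_antisymm
  · exact Nat.sInf_le h'
  · by_contra! hlt
    have : c.level t ∈ {j | ¬ (c.period (j + 1) : ℤ) ∣ t} := Nat.sInf_mem ⟨j, h'⟩
    exact this ((c.period_dvd_int hlt).trans h)

theorem not_period_dvd_of_abs_lt (c : ToeplitzCoding A) {t : ℤ} (ht : t ≠ 0) {k : ℕ}
    (h : |t| < c.period k) : ¬ (c.period k : ℤ) ∣ t := fun hd =>
  ht (Int.eq_zero_of_abs_lt_dvd hd h)

theorem exists_not_period_dvd (c : ToeplitzCoding A) {t : ℤ} (ht : t ≠ 0) :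
    ∃ j, ¬ (c.period (j + 1) : ℤ) ∣ t := by
  refine ⟨t.natAbs, c.not_period_dvd_of_abs_lt ht ?_⟩
  have := c.lt_period (t.natAbs + 1)
  rw [Int.abs_eq_natAbs]
  omega

theorem not_period_level_succ_dvd (c : ToeplitzCoding A) {t : ℤ} (ht : t ≠ 0) :
    ¬ (c.period (c.level t + 1) : ℤ) ∣ t :=
  Nat.sInf_mem (c.exists_not_period_dvd ht)

theorem period_level_dvd (c : ToeplitzCoding A) (t : ℤ) : (c.period (c.level t) : ℤ) ∣ t := by
  rcases h : c.level t with _ | j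
  · simp [period]
  · by_contra hn
    have : c.level t ≤ j := Nat.sInf_le hn
    omega

/-- The origin is excluded because `level 0` is the infimum of the empty set, hence `0`, although
every period divides `0`. -/
theorem le_level_iff (c : ToeplitzCoding A) {t : ℤ} (ht : t ≠ 0) {k : ℕ} :
    k ≤ c.level t ↔ (c.period k : ℤ) ∣ t := by
  constructor
  · exact fun h => (c.period_dvd_int h).trans (c.period_level_dvd t)
  · intro h
    by_contra! hlt
    exact c.not_period_level_succ_dvd ht ((c.period_dvd_int hlt).trans h)

/-- A level below `k` is decided by divisibility by `period j` with `j ≤ k`, which only sees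
residues modulo `period k`. -/
theorem level_congr (c : ToeplitzCoding A) {s t : ℤ} {k : ℕ} (ht : ¬ (c.period k : ℤ) ∣ t)
    (h : (c.period k : ℤ) ∣ s - t) : c.level s = c.level t := by
  have ht0 : t ≠ 0 := by rintro rfl; simp at ht
  have hlt : c.level t < k := by
    by_contra! hle
    exact ht ((c.le_level_iff ht0).1 hle)
  have key : ∀ j ≤ k, ((c.period j : ℤ) ∣ s ↔ (c.period j : ℤ) ∣ t) := fun j hj =>
    dvd_iff_dvd_of_dvd_sub ((c.period_dvd_int hj).trans h)
  refine c.level_eq ((key _ hlt.le).2 (c.period_level_dvd t)) ?_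
  rw [key _ hlt]
  exact c.not_period_level_succ_dvd ht0

theorem level_period (c : ToeplitzCoding A) (k : ℕ) : c.level (c.period k) = k := by
  refine c.level_eq dvd_rfl fun h => ?_
  have := Nat.le_of_dvd (c.period_pos k) (Int.natCast_dvd_natCast.1 h)
  exact absurd (c.period_lt_succ k) (by omega)

theorem level_period_mul (c : ToeplitzCoding A) {k j : ℕ} (h0 : 0 < j) (hj : j < c.n k) :
    c.level (c.period k * j : ℤ) = k := by
  refine c.level_eq (Dvd.intro _ rfl) fun h => ?_
  have h1 : c.period (k + 1) ∣ c.period k * j := by exact_mod_cast h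
  rw [period_succ] at h1
  have := Nat.le_of_dvd h0 (Nat.dvd_of_mul_dvd_mul_left (c.period_pos k) h1)
  omega

/-- Two positions have the same letter if they differ by a multiple of `period k` and neither is a
hole of level beyond `k`. -/
theorem level_add_eq (c : ToeplitzCoding A) {k : ℕ} {q t : ℤ} (hq : (c.period k : ℤ) ∣ q)
    (ht : ¬ (c.period (k + 1) : ℤ) ∣ t) (hqt : ¬ (c.period (k + 1) : ℤ) ∣ q + t) :
    c.level (q + t) = c.level t := by
  by_cases h : (c.period k : ℤ) ∣ t
  · rw [c.level_eq h ht, c.level_eq (dvd_add hq h) hqt]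
  · exact c.level_congr h (by simpa using hq)

/-- Position `0` is the hole in front of the word, hence the offset `i + 1`. Each appended separator
lands on a multiple of `period k` of level exactly `k`, and the block after it repeats by
periodicity. -/
theorem block_append_eq (c : ToeplitzCoding A) (k : ℕ)
    (hk : c.block k = (List.range (c.period k - 1)).map fun i : ℕ => c.a (c.level (i + 1)))
    (m : ℕ) (hm : m < c.n k) :
    c.block k ++ (List.replicate m (c.a k :: c.block k)).flatten =
      (List.range (c.period k * (m + 1) - 1)).map fun i : ℕ => c.a (c.level (i + 1)) := by
  have hP := c.period_pos k
  induction m with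
  | zero => simpa using hk
  | succ m ih =>
    have e1 : c.period k * (m + 1 + 1) - 1
        = (c.period k * (m + 1) - 1) + (1 + (c.period k - 1)) := by
      have : c.period k * (m + 1 + 1) = c.period k * (m + 1) + c.period k := by ring
      have : 0 < c.period k * (m + 1) := by positivity
      omega
    have hpos : 0 < c.period k * (m + 1) := by positivity
    rw [List.replicate_succ', List.flatten_append, ← List.append_assoc, ih (by omega), e1,
      List.range_add, List.map_append, List.range_add, List.map_append]
    congr 1
    simp only [List.range_one, List.map_cons, List.map_nil, List.map_map, List.flatten_cons,
      List.flatten_nil, List.append_nil, List.cons_append, List.nil_append, add_zero]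
    congr 1
    · congr 1
      refine (c.level_period_mul (Nat.succ_pos m) hm).symm.trans ?_
      congr 1
      push_cast [Nat.cast_sub (show 1 ≤ c.period k * (m + 1) from hpos)]
      ring
    · rw [hk]
      apply List.map_congr_left
      intro i hi
      rw [List.mem_range] at hi
      simp only [Function.comp_apply]
      congr 1
      symm
      apply c.level_congr (k := k)
      · apply c.not_period_dvd_of_abs_lt (by omega)
        rw [abs_of_pos (by omega)]
        omega
      · push_cast [Nat.cast_sub (show 1 ≤ c.period k * (m + 1) from hpos)]
        exact ⟨m + 1, by ring⟩

theorem block_eq_map (c : ToeplitzCoding A) (k : ℕ) :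
    c.block k = (List.range (c.period k - 1)).map fun i : ℕ => c.a (c.level (i + 1)) := by
  induction k with
  | zero => simp [block, period]
  | succ k ih =>
    have h2 := c.two_le_n k
    have := c.block_append_eq k ih (c.n k - 1) (by omega)
    rw [Nat.sub_add_cancel (by omega), ← period_succ] at this
    exact this

theorem limitWord_eq_level (c : ToeplitzCoding A) (i : ℕ) :
    c.limitWord i = c.a (c.level (i + 1)) := by
  have h := c.le_length_block (i + 1)
  rw [c.limitWord_eq (i + 1) i h]
  simp [c.block_eq_map]

/-! ### Leading sequences and condition (α). -/

/-- The two-sided sequence obtained from the limit word and its reflection by placing the letter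
`x` at the origin. -/
noncomputable def leadingSeq (c : ToeplitzCoding A) (x : A) (t : ℤ) : A :=
  if t = 0 then x else c.a (c.level t)

theorem leadingSeq_of_ne (c : ToeplitzCoding A) (x : A) {t : ℤ} (ht : t ≠ 0) :
    c.leadingSeq x t = c.a (c.level t) := if_neg ht

/-- Translation by `period k` moves the origin to a hole filled with `a_k`; all other positions in
this range are determined modulo `period k`. -/
theorem leadingSeq_eq_of_abs_lt (c : ToeplitzCoding A) (k : ℕ) {t : ℤ}
    (ht : |t| < c.period k) :
    c.leadingSeq (c.a k) t = c.a (c.level (c.period k + t)) := by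
  unfold leadingSeq
  split_ifs with h
  · rw [h, add_zero, level_period]
  · rw [c.level_congr (s := c.period k + t) (c.not_period_dvd_of_abs_lt h ht) (by simp)]

theorem mem_toeplitzSet_iff (c : ToeplitzCoding A) (ω : ℤ → A) :
    ω ∈ c.toeplitzSet ↔
      ∀ (k : ℤ) (n : ℕ), ∃ m : ℕ, ∀ i < n, ω (k + i) = c.a (c.level (m + 1 + i : ℤ)) := by
  simp only [toeplitzSet, Set.mem_ofPred_eq, wordAt, List.ofFn_inj, funext_iff, Fin.forall_iff,
    limitWord_eq_level]
  refine forall₂_congr fun k n => exists_congr fun m => forall₂_congr fun i _ => ?_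
  push_cast
  rw [add_right_comm]

theorem leadingSeq_mem (c : ToeplitzCoding A) {x : A} (hx : ∃ᶠ k in atTop, c.a k = x) :
    c.leadingSeq x ∈ c.toeplitzSet := by
  rw [mem_toeplitzSet_iff]
  intro k n
  obtain ⟨j, rfl, hj⟩ := (hx.and_eventually (eventually_ge_atTop (k.natAbs + n))).exists
  have hP := c.lt_period j
  refine ⟨(c.period j + k - 1).toNat, fun i hi => ?_⟩
  rw [c.leadingSeq_eq_of_abs_lt j (by rw [abs_lt]; omega)]
  congr 2
  omega

theorem exists_dvd_add (c : ToeplitzCoding A) (k : ℕ) (u : ℤ) :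
    ∃ i < c.period k, (c.period k : ℤ) ∣ u + i := by
  have hP : (0 : ℤ) < c.period k := by exact_mod_cast c.period_pos k
  have h0 := Int.emod_nonneg (-u) hP.ne'
  have h1 := Int.emod_lt_of_pos (-u) hP
  refine ⟨((-u) % c.period k).toNat, by omega, ?_⟩
  rw [Int.toNat_of_nonneg h0]
  have := Int.dvd_sub_self_of_emod_eq (rfl : (-u) % (c.period k : ℤ) = _)
  have e : u + -u % (c.period k : ℤ) = (-u % (c.period k : ℤ) - -u) := by ring
  rw [e]
  exact this

/-- A factor of the limit word that is long enough to meet a hole of level `K` is a factor of a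
leading sequence `leadingSeq (a j)` around the origin, for some `j ≥ K`. -/
theorem exists_leadingSeq_window (c : ToeplitzCoding A) {K n : ℕ} (hn : c.period K ≤ n) (m : ℕ) :
    ∃ j ≥ K, ∃ k < n, ∀ i < n,
      c.a (c.level (m + 1 + i : ℤ)) = c.leadingSeq (c.a j) (-k + i) := by
  obtain ⟨i₁, hi₁, hd₁⟩ := c.exists_dvd_add K (m + 1)
  -- The position of highest level in the window becomes the origin of the leading sequence.
  obtain ⟨k, hk, hmax⟩ := Finset.exists_max_image (Finset.range n)
    (fun i => c.level (m + 1 + i : ℤ)) ⟨i₁, Finset.mem_range.2 (by omega)⟩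
  rw [Finset.mem_range] at hk
  simp only [Finset.mem_range] at hmax
  have hne : ∀ i : ℕ, (m + 1 + i : ℤ) ≠ 0 := fun i => by omega
  have hnd : ∀ i < n, ¬ (c.period (c.level (m + 1 + k : ℤ) + 1) : ℤ) ∣ m + 1 + i := by
    intro i hi hd
    have := (c.le_level_iff (hne i)).2 hd
    have := hmax i hi
    omega
  refine ⟨c.level (m + 1 + k : ℤ),
    ((c.le_level_iff (hne _)).2 hd₁).trans (hmax i₁ (by omega)), k, hk, fun i hi => ?_⟩
  unfold leadingSeq
  split_ifs with h
  · congr 3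
    omega
  · congr 1
    have := c.level_add_eq (t := -k + i) (c.period_level_dvd (m + 1 + k)) ?_ ?_
    · rw [← this]
      congr 1
      ring
    · apply c.not_period_dvd_of_abs_lt h
      -- Two positions of the window at distance at least `period (j + 1)`, with `j` the maximal
      -- level, would enclose a multiple of `period (j + 1)`, a position of higher level.
      by_contra! hle
      obtain ⟨u, hu, hd⟩ := c.exists_dvd_add (c.level (m + 1 + k : ℤ) + 1) (m + 1 + min i k)
      have hlt : min i k + u < n := by
        rcases abs_cases (-k + i : ℤ) with ⟨h1, _⟩ | ⟨h1, _⟩ <;> omega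
      refine hnd _ hlt ?_
      push_cast at hd ⊢
      rwa [← add_assoc]
    · rw [show (m + 1 + k + (-k + i) : ℤ) = m + 1 + i by ring]
      exact hnd i hi

theorem eventually_frequently_eq [Finite A] (c : ToeplitzCoding A) :
    ∀ᶠ j in atTop, ∃ᶠ k in atTop, c.a k = c.a j := by
  have : ∀ᶠ j in atTop, ∀ x : A, c.a j = x → ∃ᶠ k in atTop, c.a k = x := by
    rw [eventually_all]
    intro x
    by_cases h : ∃ᶠ k in atTop, c.a k = x
    · exact Eventually.of_forall fun _ _ => h
    · filter_upwards [not_frequently.1 h] with j hj hx using absurd hx hj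
  exact this.mono fun j h => h _ rfl

theorem wordAt_eq_iff {ω ρ : ℤ → A} {k l : ℤ} {n : ℕ} :
    wordAt ω k n = wordAt ρ l n ↔ ∀ i < n, ω (k + (i : ℕ)) = ρ (l + (i : ℕ)) := by
  simp only [wordAt, List.ofFn_inj, funext_iff, Fin.forall_iff]

variable [TopologicalSpace A] [DiscreteTopology A]

/-- The leading sequence of a letter that occurs infinitely often, as a point of the subshift. -/
noncomputable def leadingPoint (c : ToeplitzCoding A) (x : {x : A | ∃ᶠ k in atTop, c.a k = x}) :
    c.subshift.carrier :=
  ⟨c.leadingSeq x, c.leadingSeq_mem x.2⟩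

/-- Every long word of the subshift occurs around the origin in a leading sequence. -/
theorem eventually_exists_leadingPoint [Finite A] (c : ToeplitzCoding A) :
    ∀ᶠ n : ℕ in atTop, ∀ (ω : c.subshift.carrier) (l : ℤ), ∃ x, ∃ k < n, ∀ i < n,
      ω.1 (l + (i : ℕ)) = (c.leadingPoint x).1 (-(k : ℤ) + (i : ℕ)) := by
  obtain ⟨K, hK⟩ := eventually_atTop.1 c.eventually_frequently_eq
  filter_upwards [eventually_ge_atTop (c.period K)] with n hn ω l
  obtain ⟨m, hm⟩ := (c.mem_toeplitzSet_iff ω.1).1 ω.2 l n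
  obtain ⟨j, hj, k, hk, h⟩ := c.exists_leadingSeq_window hn m
  exact ⟨⟨c.a j, hK j hj⟩, k, hk, fun i hi => (hm i hi).trans (h i hi)⟩

theorem leadingAlpha [Finite A] (c : ToeplitzCoding A) {r : ℕ}
    (e : Fin r ≃ {x : A | ∃ᶠ k in atTop, c.a k = x}) :
    c.subshift.LeadingAlpha fun j => c.leadingPoint (e j) := by
  obtain ⟨N, hN⟩ := eventually_atTop.1 c.eventually_exists_leadingPoint
  refine ⟨N, fun n hn => Set.ext fun w => ⟨?_, ?_⟩⟩
  · rintro ⟨ω, hω, l, rfl⟩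
    obtain ⟨x, k, hk, h⟩ := hN n hn ⟨ω, hω⟩ l
    -- `LeadingAlpha` starts its words at `-k + 1`, so a start at `-k` corresponds to the index `k +
    -- 1 ≤ n`.
    refine ⟨e.symm x, k + 1, hk, wordAt_eq_iff.2 fun i hi => ?_⟩
    have := h i hi
    simp only [Equiv.apply_symm_apply]
    rw [show -((k + 1 : ℕ) : ℤ) + 1 + i = -(k : ℤ) + i by push_cast; ring]
    exact this
  · rintro ⟨j, k, -, rfl⟩
    exact ⟨_, (c.leadingPoint (e j)).2, _, rfl⟩

end ToeplitzCoding

/-! ## The action of `SL(2,ℝ)` on the Euclidean plane -/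

/-- The special linear group of the plane. -/
abbrev SL2 := Matrix.SpecialLinearGroup (Fin 2) ℝ

/-- The Euclidean plane. -/
abbrev Plane := EuclideanSpace ℝ (Fin 2)

/-- The signed area of the parallelogram spanned by two vectors. -/
def cross (v w : Plane) : ℝ := v 0 * w 1 - v 1 * w 0

theorem slToCLM_apply (B : SL2) (v : Plane) (i : Fin 2) :
    slToCLM B v i = B i 0 * v 0 + B i 1 * v 1 := by
  simp [slToCLM, Matrix.ofLp_toEuclideanCLM, Matrix.mulVec, dotProduct, Fin.sum_univ_two]

theorem slToCLM_mul (B C : SL2) : slToCLM (B * C) = slToCLM B * slToCLM C := by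
  simp [slToCLM]

theorem slToCLM_one : slToCLM 1 = 1 := by
  simp [slToCLM]

theorem slToCLM_mul_apply (B C : SL2) (v : Plane) :
    slToCLM (B * C) v = slToCLM B (slToCLM C v) := by
  rw [slToCLM_mul, mul_apply_eq_comp]

theorem slToCLM_inv_apply (B : SL2) (v : Plane) : slToCLM B⁻¹ (slToCLM B v) = v := by
  rw [← slToCLM_mul_apply, inv_mul_cancel, slToCLM_one, one_apply_eq_self]

theorem cross_map (B : SL2) (v w : Plane) : cross (slToCLM B v) (slToCLM B w) = cross v w := by
  have hdet := B.det_coe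
  rw [Matrix.det_fin_two] at hdet
  simp only [cross, slToCLM_apply]
  linear_combination (v 0 * w 1 - v 1 * w 0) * hdet

theorem abs_cross_comm (v w : Plane) : |cross v w| = |cross w v| := by
  rw [← abs_neg]
  congr 1
  simp only [cross]
  ring

theorem norm_sq_plane (v : Plane) : ‖v‖ ^ 2 = v 0 ^ 2 + v 1 ^ 2 := by
  simp [EuclideanSpace.norm_sq_eq, Fin.sum_univ_two]

theorem abs_dot_le (v w : Plane) : |v 0 * w 0 + v 1 * w 1| ≤ ‖v‖ * ‖w‖ := by
  apply abs_le_of_sq_le_sq _ (by positivity)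
  rw [mul_pow, norm_sq_plane, norm_sq_plane]
  nlinarith [sq_nonneg (v 0 * w 1 - v 1 * w 0)]

theorem abs_cross_le (v w : Plane) : |cross v w| ≤ ‖v‖ * ‖w‖ := by
  apply abs_le_of_sq_le_sq _ (by positivity)
  rw [mul_pow, norm_sq_plane, norm_sq_plane, cross]
  nlinarith [sq_nonneg (v 0 * w 0 + v 1 * w 1)]

theorem exists_cross_eq (v : Plane) : ∃ w : Plane, ‖w‖ = ‖v‖ ∧ cross v w = ‖v‖ ^ 2 := by
  refine ⟨!₂[-v 1, v 0], ?_, ?_⟩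
  · rw [← sq_eq_sq₀ (norm_nonneg _) (norm_nonneg _), norm_sq_plane, norm_sq_plane]
    simp
    ring
  · rw [norm_sq_plane]
    simp [cross]
    ring

/-- Subadditivity of the sine of the angle between lines. -/
theorem norm_mul_abs_cross_le (u v w : Plane) :
    ‖u‖ * |cross v w| ≤ |cross v u| * ‖w‖ + ‖v‖ * |cross u w| := by
  rcases eq_or_ne u 0 with rfl | hu
  · rw [norm_zero, zero_mul]
    positivity
  have hu' : 0 < ‖u‖ := norm_pos_iff.2 hu
  have key : ‖u‖ ^ 2 * cross v w =
      (v 0 * u 0 + v 1 * u 1) * cross u w + cross v u * (u 0 * w 0 + u 1 * w 1) := by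
    rw [norm_sq_plane]
    simp only [cross]
    ring
  have h1 : ‖u‖ ^ 2 * |cross v w| ≤
      (‖v‖ * ‖u‖) * |cross u w| + |cross v u| * (‖u‖ * ‖w‖) := by
    rw [← abs_of_nonneg (sq_nonneg ‖u‖), ← abs_mul, key]
    refine (abs_add_le _ _).trans ?_
    rw [abs_mul, abs_mul]
    gcongr
    · exact abs_dot_le v u
    · exact abs_dot_le u w
  refine le_of_mul_le_mul_left ?_ hu'
  calc _ = ‖u‖ ^ 2 * |cross v w| := by ring
    _ ≤ _ := h1
    _ = _ := by ring

theorem abs_cross_triangle {u v w : Plane} (hu : ‖u‖ = 1) (hw : ‖w‖ = 1) :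
    |cross v w| ≤ |cross v u| + ‖v‖ * |cross u w| := by
  simpa [hu, hw] using norm_mul_abs_cross_le u v w

/-- Area preservation: the square spanned by `z` and its rotation by a right angle keeps its area
`‖z‖²` under `B`, and one of the two image sides is `u`. -/
theorem norm_slToCLM_inv_le (B : SL2) : ‖slToCLM B⁻¹‖ ≤ ‖slToCLM B‖ := by
  refine ContinuousLinearMap.opNorm_le_bound _ (norm_nonneg _) fun u => ?_
  set z := slToCLM B⁻¹ u with hz
  obtain ⟨w, hw, hzw⟩ := exists_cross_eq z
  have hBz : slToCLM B z = u := by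
    rw [hz, ← slToCLM_mul_apply, mul_inv_cancel, slToCLM_one, one_apply_eq_self]
  rcases eq_or_ne z 0 with h0 | h0
  · rw [h0, norm_zero]
    positivity
  have hpos : 0 < ‖z‖ := norm_pos_iff.2 h0
  refine le_of_mul_le_mul_right ?_ hpos
  calc ‖z‖ * ‖z‖ = cross z w := by rw [hzw]; ring
    _ = cross u (slToCLM B w) := by rw [← cross_map B, hBz]
    _ ≤ ‖u‖ * ‖slToCLM B w‖ := (le_abs_self _).trans (abs_cross_le _ _)
    _ ≤ ‖u‖ * (‖slToCLM B‖ * ‖w‖) := by gcongr; exact ContinuousLinearMap.le_opNorm _ _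
    _ = _ := by rw [hw]; ring

theorem norm_slToCLM_inv (B : SL2) : ‖slToCLM B⁻¹‖ = ‖slToCLM B‖ :=
  le_antisymm (norm_slToCLM_inv_le B) (by simpa using norm_slToCLM_inv_le B⁻¹)

theorem norm_slToCLM_mul_le (B C : SL2) :
    ‖slToCLM (B * C)‖ ≤ ‖slToCLM B‖ * ‖slToCLM C‖ := by
  rw [slToCLM_mul]
  exact norm_mul_le _ _

theorem one_le_norm_slToCLM (B : SL2) : 1 ≤ ‖slToCLM B‖ := by
  have h := norm_slToCLM_mul_le B⁻¹ B
  rw [inv_mul_cancel, slToCLM_one, norm_one, norm_slToCLM_inv] at h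
  nlinarith [norm_nonneg (slToCLM B)]

theorem norm_slToCLM_pos (B : SL2) : 0 < ‖slToCLM B‖ :=
  zero_lt_one.trans_le (one_le_norm_slToCLM B)

theorem log_norm_slToCLM_nonneg (B : SL2) : 0 ≤ Real.log ‖slToCLM B‖ :=
  Real.log_nonneg (one_le_norm_slToCLM B)

theorem log_norm_slToCLM_mul_le (B C : SL2) :
    Real.log ‖slToCLM (B * C)‖ ≤ Real.log ‖slToCLM B‖ + Real.log ‖slToCLM C‖ := by
  rw [← Real.log_mul (norm_slToCLM_pos B).ne' (norm_slToCLM_pos C).ne']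
  exact Real.log_le_log (norm_slToCLM_pos _) (norm_slToCLM_mul_le B C)

theorem log_norm_slToCLM_inv (B : SL2) :
    Real.log ‖slToCLM B⁻¹‖ = Real.log ‖slToCLM B‖ := by
  rw [norm_slToCLM_inv]

theorem log_norm_slToCLM_right_le (B C : SL2) :
    Real.log ‖slToCLM C‖ ≤ Real.log ‖slToCLM (B * C)‖ + Real.log ‖slToCLM B‖ := by
  have := log_norm_slToCLM_mul_le B⁻¹ (B * C)
  rw [inv_mul_cancel_left, log_norm_slToCLM_inv] at this
  linarith

theorem log_norm_slToCLM_left_le (B C : SL2) :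
    Real.log ‖slToCLM B‖ ≤ Real.log ‖slToCLM (B * C)‖ + Real.log ‖slToCLM C‖ := by
  have := log_norm_slToCLM_mul_le (B * C) C⁻¹
  rw [mul_inv_cancel_right, log_norm_slToCLM_inv] at this
  linarith

theorem norm_le_norm_slToCLM_mul (B : SL2) (v : Plane) :
    ‖v‖ ≤ ‖slToCLM B‖ * ‖slToCLM B v‖ := by
  conv_lhs => rw [← slToCLM_inv_apply B v]
  rw [← norm_slToCLM_inv]
  exact ContinuousLinearMap.le_opNorm _ _

theorem slToCLM_apply_ne_zero (B : SL2) {v : Plane} (hv : v ≠ 0) : slToCLM B v ≠ 0 := by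
  intro h
  have := slToCLM_inv_apply B v
  rw [h, map_zero] at this
  exact hv this.symm

theorem abs_log_norm_apply_sub_le (B : SL2) {v : Plane} (hv : v ≠ 0) :
    |Real.log ‖slToCLM B v‖ - Real.log ‖v‖| ≤ Real.log ‖slToCLM B‖ := by
  have hv0 : 0 < ‖v‖ := norm_pos_iff.2 hv
  have hB0 := norm_slToCLM_pos B
  have hBv : 0 < ‖slToCLM B v‖ := norm_pos_iff.2 (slToCLM_apply_ne_zero B hv)
  have h1 := Real.log_le_log hBv (ContinuousLinearMap.le_opNorm (slToCLM B) v)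
  have h2 := Real.log_le_log hv0 (norm_le_norm_slToCLM_mul B v)
  rw [Real.log_mul hB0.ne' hv0.ne'] at h1
  rw [Real.log_mul hB0.ne' hBv.ne'] at h2
  rw [abs_le]
  constructor <;> linarith

theorem exists_norm_slToCLM_apply_eq (B : SL2) :
    ∃ u : Plane, ‖u‖ = 1 ∧ ‖slToCLM B u‖ = ‖slToCLM B‖ := by
  obtain ⟨u, hu, hmax⟩ := (isCompact_sphere (0 : Plane) 1).exists_isMaxOn
    (NormedSpace.sphere_nonempty.2 zero_le_one)
    ((slToCLM B).continuous.norm.continuousOn)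
  have hu1 : ‖u‖ = 1 := mem_sphere_zero_iff_norm.1 hu
  refine ⟨u, hu1, le_antisymm ?_ ?_⟩
  · simpa [hu1] using (slToCLM B).le_opNorm u
  · refine ContinuousLinearMap.opNorm_le_of_unit_norm (norm_nonneg _) fun x hx => ?_
    exact hmax (mem_sphere_zero_iff_norm.2 hx)

/-- A unit vector that is contracted by the maximal factor. -/
def IsContracted (B : SL2) (s : Plane) : Prop :=
  ‖s‖ = 1 ∧ ‖slToCLM B s‖ = ‖slToCLM B‖⁻¹

/-- The preimage of a vector that `B⁻¹` stretches most, normalized, is shrunk most by `B`. -/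
theorem exists_isContracted (B : SL2) : ∃ s, IsContracted B s := by
  obtain ⟨u, hu, h⟩ := exists_norm_slToCLM_apply_eq B⁻¹
  rw [norm_slToCLM_inv] at h
  have hB := norm_slToCLM_pos B
  refine ⟨‖slToCLM B‖⁻¹ • slToCLM B⁻¹ u, ?_, ?_⟩
  · rw [norm_smul, h, norm_inv, norm_norm, inv_mul_cancel₀ hB.ne']
  · rw [map_smul, ← slToCLM_mul_apply, mul_inv_cancel, slToCLM_one,
      one_apply_eq_self, norm_smul, hu, norm_inv, norm_norm, mul_one]

theorem IsContracted.abs_cross_mul_le {B : SL2} {s : Plane} (hs : IsContracted B s) (v : Plane) :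
    |cross v s| * ‖slToCLM B‖ ≤ ‖slToCLM B v‖ := by
  rw [← cross_map B]
  have h := abs_cross_le (slToCLM B v) (slToCLM B s)
  rw [hs.2] at h
  have hB := norm_slToCLM_pos B
  rwa [← div_eq_mul_inv, le_div_iff₀ hB] at h

/-- Split `v` along `s` and its orthogonal `z`; the component along `z` has length `|cross v s|`. -/
theorem norm_le_of_cross (s v : Plane) (hs : ‖s‖ = 1) (B : SL2) :
    ‖slToCLM B v‖ ≤ ‖v‖ * ‖slToCLM B s‖ + |cross v s| * ‖slToCLM B‖ := by
  obtain ⟨z, hz⟩ : ∃ z : Plane, z = !₂[-s 1, s 0] := ⟨_, rfl⟩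
  have hs2 := norm_sq_plane s
  rw [hs] at hs2
  have hzn : ‖z‖ = 1 := by
    rw [← sq_eq_sq₀ (norm_nonneg _) zero_le_one, norm_sq_plane, hz]
    simp
    linarith
  have hv : v = (v 0 * s 0 + v 1 * s 1) • s - cross v s • z := by
    ext i
    fin_cases i
    · simp [hz, cross]
      linear_combination (v 0) * hs2
    · simp [hz, cross]
      linear_combination (v 1) * hs2
  have hdot := abs_dot_le v s
  rw [hs, mul_one] at hdot
  calc ‖slToCLM B v‖
      = ‖(v 0 * s 0 + v 1 * s 1) • slToCLM B s - cross v s • slToCLM B z‖ := by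
        conv_lhs => rw [hv]
        rw [map_sub, map_smul, map_smul]
    _ ≤ |v 0 * s 0 + v 1 * s 1| * ‖slToCLM B s‖ + |cross v s| * ‖slToCLM B z‖ := by
        refine (norm_sub_le _ _).trans ?_
        rw [norm_smul, norm_smul, Real.norm_eq_abs, Real.norm_eq_abs]
    _ ≤ _ := by
        gcongr
        simpa [hzn] using (slToCLM B).le_opNorm z

theorem IsContracted.norm_apply_le {B : SL2} {s : Plane} (hs : IsContracted B s) (v : Plane) :
    ‖slToCLM B v‖ ≤ ‖v‖ * ‖slToCLM B‖⁻¹ + |cross v s| * ‖slToCLM B‖ := by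
  rw [← hs.2]
  exact norm_le_of_cross s v hs.1 B

/-- The norm of `B C⁻¹` is comparable with the product of the norms if the contracted directions
are transversal. -/
theorem IsContracted.mul_norm_le {B C : SL2} {s t : Plane} (hs : IsContracted B s)
    (ht : IsContracted C t) :
    |cross t s| * (‖slToCLM B‖ * ‖slToCLM C‖) ≤ ‖slToCLM (B * C⁻¹)‖ := by
  have h1 := hs.abs_cross_mul_le t
  have h2 := (slToCLM (B * C⁻¹)).le_opNorm (slToCLM C t)
  rw [slToCLM_mul_apply, slToCLM_inv_apply, ht.2] at h2
  have hC := norm_slToCLM_pos C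
  have h3 := h1.trans h2
  rw [← div_eq_mul_inv, le_div_iff₀ hC] at h3
  linarith

/-- The vector `C⁻¹ u` has length at most `‖C‖` and lies within `‖C‖⁻¹` of the line of `t`, so `B`
can expand it strongly only as far as `t` is transversal to `s`. -/
theorem IsContracted.norm_mul_inv_le {B C : SL2} {s t : Plane} (hs : IsContracted B s)
    (ht : IsContracted C t) :
    ‖slToCLM (B * C⁻¹)‖ ≤ ‖slToCLM C‖ * ‖slToCLM B‖⁻¹ + ‖slToCLM B‖ * ‖slToCLM C‖⁻¹ +
      |cross t s| * (‖slToCLM B‖ * ‖slToCLM C‖) := by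
  refine ContinuousLinearMap.opNorm_le_of_unit_norm (by positivity) fun u hu => ?_
  set z := slToCLM C⁻¹ u with hz
  have hzn : ‖z‖ ≤ ‖slToCLM C‖ := by
    have := (slToCLM C⁻¹).le_opNorm u
    rwa [hu, mul_one, norm_slToCLM_inv] at this
  have hCz : slToCLM C z = u := by
    rw [hz, ← slToCLM_mul_apply, mul_inv_cancel, slToCLM_one, one_apply_eq_self]
  have hzt : |cross z t| ≤ ‖slToCLM C‖⁻¹ := by
    rw [← cross_map C, hCz, ← ht.2]
    simpa [hu] using abs_cross_le u (slToCLM C t)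
  have hts : |cross z s| ≤ ‖slToCLM C‖⁻¹ + ‖slToCLM C‖ * |cross t s| :=
    (abs_cross_triangle ht.1 hs.1).trans (by gcongr)
  rw [slToCLM_mul_apply, ← hz]
  calc _ ≤ ‖z‖ * ‖slToCLM B‖⁻¹ + |cross z s| * ‖slToCLM B‖ := hs.norm_apply_le z
    _ ≤ ‖slToCLM C‖ * ‖slToCLM B‖⁻¹ +
        (‖slToCLM C‖⁻¹ + ‖slToCLM C‖ * |cross t s|) * ‖slToCLM B‖ := by gcongr
    _ = _ := by ring

/-! ## Products of matrices with a positive Lyapunov exponent -/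

/-- A sequence of partial products with bounded factors and with growth rate `L`. -/
structure HasGrowthRate (X : ℕ → SL2) (L : ℝ) : Prop where
  step : ∃ K : ℝ, ∀ l, ‖slToCLM (X (l + 1) * (X l)⁻¹)‖ ≤ K
  tendsto : Tendsto (fun l : ℕ => Real.log ‖slToCLM (X l)‖ / l) atTop (𝓝 L)

namespace HasGrowthRate

variable {X Y : ℕ → SL2} {L : ℝ} {s t : ℕ → Plane}

theorem eventually_exp_le (hX : HasGrowthRate X L) {a : ℝ} (ha : a < L) :
    ∀ᶠ l : ℕ in atTop, Real.exp (a * l) ≤ ‖slToCLM (X l)‖ := by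
  filter_upwards [hX.tendsto.eventually_const_le ha, eventually_gt_atTop 0] with l hl h0
  have h0' : (0 : ℝ) < l := by exact_mod_cast h0
  rw [le_div_iff₀ h0'] at hl
  rwa [← Real.le_log_iff_exp_le (norm_slToCLM_pos _)]

theorem eventually_le_exp (hX : HasGrowthRate X L) {b : ℝ} (hb : L < b) :
    ∀ᶠ l : ℕ in atTop, ‖slToCLM (X l)‖ ≤ Real.exp (b * l) := by
  filter_upwards [hX.tendsto.eventually_le_const hb, eventually_gt_atTop 0] with l hl h0
  have h0' : (0 : ℝ) < l := by exact_mod_cast h0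
  rw [div_le_iff₀ h0'] at hl
  rwa [← Real.log_le_iff_le_exp (norm_slToCLM_pos _)]

/-- The most contracted directions converge exponentially fast. -/
theorem exists_abs_cross_le (hX : HasGrowthRate X L) (hs : ∀ l, IsContracted (X l) (s l))
    {a : ℝ} (ha0 : 0 < a) (ha : a < L) :
    ∃ C : ℝ, 0 ≤ C ∧ ∀ᶠ l : ℕ in atTop, ∀ j ≥ l,
      |cross (s l) (s j)| ≤ C * Real.exp (-(2 * a) * l) := by
  obtain ⟨K, hK⟩ := hX.step
  obtain ⟨l₀, hl₀⟩ := eventually_atTop.1 (hX.eventually_exp_le ha)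
  have hK0 : 0 ≤ K := (norm_nonneg _).trans (hK 0)
  set θ := Real.exp (-(2 * a)) with hθ
  have hθ0 : 0 < θ := Real.exp_pos _
  have hθ1 : θ < 1 := Real.exp_lt_one_iff.2 (by linarith)
  have hpow : ∀ l : ℕ, Real.exp (-(2 * a) * l) = θ ^ l := fun l => by
    rw [hθ, ← Real.exp_nat_mul, mul_comm]
  -- `X (l + 1)` still shrinks `s l` to order `‖X l‖⁻¹`, but expands the component transversal to `s
  -- (l + 1)` by `‖X (l + 1)‖`. The quotient of the two rates gives the exponent `-2a`.
  have hstep : ∀ l ≥ l₀, |cross (s l) (s (l + 1))| ≤ K * θ ^ l := by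
    intro l hl
    have h1 := (hs (l + 1)).abs_cross_mul_le (s l)
    have h2 : ‖slToCLM (X (l + 1)) (s l)‖ ≤ K * ‖slToCLM (X l)‖⁻¹ := by
      rw [← (hs l).2]
      have := (slToCLM (X (l + 1) * (X l)⁻¹)).le_opNorm (slToCLM (X l) (s l))
      rw [← slToCLM_mul_apply, inv_mul_cancel_right] at this
      exact this.trans (by gcongr; exact hK l)
    have e1 : Real.exp (a * l) ≤ ‖slToCLM (X (l + 1))‖ :=
      le_trans (Real.exp_le_exp.2 (by push_cast; nlinarith)) (hl₀ (l + 1) (by omega))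
    have e2 : ‖slToCLM (X l)‖⁻¹ ≤ Real.exp (-(a * l)) := by
      rw [Real.exp_neg]
      exact inv_anti₀ (Real.exp_pos _) (hl₀ l hl)
    have h3 : |cross (s l) (s (l + 1))| * Real.exp (a * l) ≤ K * Real.exp (-(a * l)) :=
      ((mul_le_mul_of_nonneg_left e1 (abs_nonneg _)).trans h1).trans
        (h2.trans (mul_le_mul_of_nonneg_left e2 hK0))
    rw [← le_div_iff₀ (Real.exp_pos _), mul_div_assoc, ← Real.exp_sub] at h3
    rw [← hpow]
    refine h3.trans (le_of_eq ?_)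
    congr 2
    ring
  refine ⟨K / (1 - θ), div_nonneg hK0 (by linarith), ?_⟩
  filter_upwards [eventually_ge_atTop l₀] with l hl j hj
  -- Subtracting `θ ^ j` is the partial geometric sum, which lets the induction telescope.
  have key : |cross (s l) (s j)| ≤ K / (1 - θ) * (θ ^ l - θ ^ j) := by
    induction j, hj using Nat.le_induction with
    | base => simp [cross, mul_comm]
    | succ j hj ih =>
      have h1 := abs_cross_triangle (v := s l) (hs j).1 (hs (j + 1)).1
      rw [(hs l).1, one_mul] at h1
      have h2 := hstep j (hl.trans hj)
      have h3 : K / (1 - θ) * (θ ^ l - θ ^ (j + 1)) =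
          K / (1 - θ) * (θ ^ l - θ ^ j) + K * θ ^ j := by
        have : (1 - θ) ≠ 0 := by linarith
        field_simp
        ring
      linarith
  rw [hpow]
  refine key.trans ?_
  have : 0 ≤ θ ^ j := by positivity
  have : 0 ≤ K / (1 - θ) := div_nonneg hK0 (by linarith)
  gcongr
  linarith

/-- A vector is either expanded at the maximal rate, or it lies in the contracted direction. -/
theorem tendsto_apply (hX : HasGrowthRate X L) (hL : 0 < L) (hs : ∀ l, IsContracted (X l) (s l))
    {v : Plane} (hv : v ≠ 0) :
    Tendsto (fun l : ℕ => Real.log ‖slToCLM (X l) v‖ / l) atTop (𝓝 L) ∨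
    (Tendsto (fun l : ℕ => Real.log ‖slToCLM (X l) v‖ / l) atTop (𝓝 (-L)) ∧
      Tendsto (fun l => |cross v (s l)|) atTop (𝓝 0)) := by
  have hv0 : 0 < ‖v‖ := norm_pos_iff.2 hv
  have hXv : ∀ l, 0 < ‖slToCLM (X l) v‖ := fun l => norm_pos_iff.2 (slToCLM_apply_ne_zero _ hv)
  have habs := fun l => abs_le.1 (abs_log_norm_apply_sub_le (X l) hv)
  -- Either `v` stays away from the contracted directions, or it comes arbitrarily close to them; in
  -- the latter case their exponential convergence makes `v` approach them exponentially too.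
  by_cases hcase : ∃ c > 0, ∀ᶠ l in atTop, c ≤ |cross v (s l)|
  · left
    obtain ⟨c, hc, hcl⟩ := hcase
    have lo : Tendsto (fun l : ℕ => Real.log c / l + Real.log ‖slToCLM (X l)‖ / l) atTop
        (𝓝 L) := by simpa using (tendsto_const_div_atTop_nhds_zero_nat (Real.log c)).add hX.tendsto
    have hi : Tendsto (fun l : ℕ => Real.log ‖v‖ / l + Real.log ‖slToCLM (X l)‖ / l) atTop
        (𝓝 L) := by simpa using (tendsto_const_div_atTop_nhds_zero_nat (Real.log ‖v‖)).add hX.tendsto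
    refine tendsto_of_tendsto_of_tendsto_of_le_of_le' lo hi ?_ ?_
    · filter_upwards [hcl] with l hl
      rw [← add_div, ← Real.log_mul hc.ne' (norm_slToCLM_pos _).ne']
      refine div_le_div_of_nonneg_right (Real.log_le_log ?_ ?_) (Nat.cast_nonneg l)
      · exact mul_pos hc (norm_slToCLM_pos _)
      · exact (mul_le_mul_of_nonneg_right hl (norm_nonneg _)).trans ((hs l).abs_cross_mul_le v)
    · refine Eventually.of_forall fun l => ?_
      rw [← add_div]
      refine div_le_div_of_nonneg_right ?_ (Nat.cast_nonneg l)
      linarith [(habs l).2]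
  · right
    push Not at hcase
    have hdecay : ∀ a, 0 < a → a < L → ∃ C : ℝ, 0 ≤ C ∧ ∀ᶠ l : ℕ in atTop,
        |cross v (s l)| ≤ C * Real.exp (-(2 * a) * l) := by
      intro a ha0 ha
      obtain ⟨C, hC, hl⟩ := hX.exists_abs_cross_le hs ha0 ha
      refine ⟨‖v‖ * C, by positivity, hl.mono fun l h => ?_⟩
      refine le_of_forall_pos_le_add fun c hc => ?_
      obtain ⟨j, hj, hjl⟩ := ((hcase c hc).and_eventually (eventually_ge_atTop l)).exists
      have h1 := abs_cross_triangle (v := v) (hs j).1 (hs l).1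
      rw [abs_cross_comm (s j)] at h1
      have h2 := mul_le_mul_of_nonneg_left (h j hjl) hv0.le
      linarith
    constructor
    · have hN := hX.tendsto.neg
      rw [tendsto_order]
      constructor
      · intro b hb
        have lo : Tendsto (fun l : ℕ => Real.log ‖v‖ / l + -(Real.log ‖slToCLM (X l)‖ / l)) atTop
            (𝓝 (-L)) := by simpa using (tendsto_const_div_atTop_nhds_zero_nat (Real.log ‖v‖)).add hN
        filter_upwards [lo.eventually_const_lt hb] with l hl
        refine hl.trans_le ?_
        rw [← neg_div, ← add_div]
        refine div_le_div_of_nonneg_right ?_ (Nat.cast_nonneg l)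
        linarith [(habs l).1]
      · intro b hb
        -- Decay `exp (-2(L - ε)l)` against growth `exp ((L + ε)l)` leaves the exponent `-L + 3ε`;
        -- the fourth `ε` pays for the multiplicative constant.
        obtain ⟨ε, hε, hεL, hεb⟩ : ∃ ε > 0, ε < L ∧ -L + 4 * ε ≤ b := by
          refine ⟨min (L / 2) ((b + L) / 4), lt_min (by linarith) (by linarith), ?_, ?_⟩
          · exact (min_le_left _ _).trans_lt (by linarith)
          · linarith [min_le_right (L / 2) ((b + L) / 4)]
        obtain ⟨C, hC, hCl⟩ := hdecay (L - ε) (by linarith) (by linarith)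
        have hlim := (tendsto_const_div_atTop_nhds_zero_nat (Real.log (‖v‖ + C))).eventually_lt_const hε
        filter_upwards [hCl, hX.eventually_exp_le (show L - ε < L by linarith),
          hX.eventually_le_exp (show L < L + ε by linarith), hlim, eventually_gt_atTop 0]
          with l h1 h2 h3 h4 h5
        have h5' : (0 : ℝ) < l := by exact_mod_cast h5
        have h6 : ‖slToCLM (X l) v‖ ≤ (‖v‖ + C) * Real.exp ((-L + 3 * ε) * l) := by
          refine ((hs l).norm_apply_le v).trans ?_
          rw [add_mul]
          refine add_le_add (mul_le_mul_of_nonneg_left ?_ hv0.le) ?_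
          · calc ‖slToCLM (X l)‖⁻¹ ≤ (Real.exp ((L - ε) * l))⁻¹ :=
                  inv_anti₀ (Real.exp_pos _) h2
              _ = Real.exp (-((L - ε) * l)) := (Real.exp_neg _).symm
              _ ≤ _ := Real.exp_le_exp.2 (by nlinarith)
          · calc _ ≤ (C * Real.exp (-(2 * (L - ε)) * l)) * Real.exp ((L + ε) * l) := by
                  gcongr
              _ = _ := by
                  rw [mul_assoc, ← Real.exp_add]
                  congr 2
                  ring
        have h7 := Real.log_le_log (hXv l) h6
        rw [Real.log_mul (by positivity) (Real.exp_pos _).ne', Real.log_exp] at h7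
        rw [div_lt_iff₀ h5'] at h4 ⊢
        nlinarith
    · obtain ⟨C, hC, hCl⟩ := hdecay (L / 2) (by linarith) (by linarith)
      refine squeeze_zero' (Eventually.of_forall fun _ => abs_nonneg _) hCl ?_
      have : Tendsto (fun l : ℕ => Real.exp (-(2 * (L / 2)) * l)) atTop (𝓝 0) := by
        refine Real.tendsto_exp_atBot.comp ?_
        exact Tendsto.const_mul_atTop_of_neg (by linarith) tendsto_natCast_atTop_atTop
      simpa using this.const_mul C

/-- If the products `X l * (Y l)⁻¹` are frequently large, then the contracted directions of `X`
and `Y` are uniformly transversal. -/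
theorem exists_le_abs_cross (hX : HasGrowthRate X L) (hY : HasGrowthRate Y L) (hL : 0 < L)
    (hs : ∀ l, IsContracted (X l) (s l)) (ht : ∀ l, IsContracted (Y l) (t l))
    (h : ∃ᶠ l : ℕ in atTop, 7 / 4 * L * l ≤ Real.log ‖slToCLM (X l * (Y l)⁻¹)‖) :
    ∃ c > 0, ∃ l₀, ∀ m ≥ l₀, ∀ j ≥ l₀, c ≤ |cross (t m) (s j)| := by
  have ha : 15 / 16 * L < L := by linarith
  have hb : L < 17 / 16 * L := by linarith
  obtain ⟨C, hC, hCl⟩ := hX.exists_abs_cross_le hs (by linarith) ha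
  obtain ⟨D, hD, hDl⟩ := hY.exists_abs_cross_le ht (by linarith) ha
  have hlarge : ∀ᶠ l : ℕ in atTop, 2 + C + D < Real.exp (3 / 2 * L * l) := by
    refine (Real.tendsto_exp_atTop.comp ?_).eventually_gt_atTop _
    exact Tendsto.const_mul_atTop (by linarith) tendsto_natCast_atTop_atTop
  obtain ⟨l, h0, h1, h2, h3, h4, h5, h6, h7⟩ := (h.and_eventually (hCl.and (hDl.and
    ((hX.eventually_exp_le ha).and ((hX.eventually_le_exp hb).and
    ((hY.eventually_exp_le ha).and ((hY.eventually_le_exp hb).and hlarge))))))).exists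
  have hl0 : (0 : ℝ) ≤ l := Nat.cast_nonneg l
  set E : ℝ → ℝ := fun x => Real.exp (x * L * l) with hE
  have hEadd : ∀ x y, E x * E y = E (x + y) := fun x y => by
    simp only [hE]
    rw [← Real.exp_add]
    congr 1
    ring
  have hEpos : ∀ x, 0 < E x := fun x => Real.exp_pos _
  have hquot : ∀ {B B' : SL2}, E (15 / 16) ≤ ‖slToCLM B‖ → ‖slToCLM B'‖ ≤ E (17 / 16) →
      ‖slToCLM B'‖ * ‖slToCLM B‖⁻¹ ≤ E (1 / 8) := by
    intro B B' hB hB'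
    rw [← div_eq_mul_inv, div_le_iff₀ (norm_slToCLM_pos _)]
    refine hB'.trans ?_
    calc E (17 / 16) = E (1 / 8) * E (15 / 16) := by rw [hEadd]; norm_num
      _ ≤ _ := by have := hEpos (1 / 8); gcongr
  -- With both norms between `E (15/16)` and `E (17/16)`, the two quotient terms are too small to
  -- account for `E (7/4)`, so the transversality term must.
  have e1 : E (7 / 4) ≤ 2 * E (1 / 8) + |cross (t l) (s l)| * E (17 / 8) := by
    rw [Real.le_log_iff_exp_le (norm_slToCLM_pos _)] at h0
    refine h0.trans (((hs l).norm_mul_inv_le (ht l)).trans ?_)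
    have q1 := hquot h3 h6
    have q2 := hquot h5 h4
    have q3 : ‖slToCLM (X l)‖ * ‖slToCLM (Y l)‖ ≤ E (17 / 8) := by
      calc _ ≤ E (17 / 16) * E (17 / 16) := by
            exact mul_le_mul h4 h6 (norm_nonneg _) (hEpos _).le
        _ = _ := by rw [hEadd]; norm_num
    have q4 := mul_le_mul_of_nonneg_left q3 (abs_nonneg (cross (t l) (s l)))
    linarith
  have e2 : E (-(3 / 8)) ≤ 2 * E (-(15 / 8)) + |cross (t l) (s l)| := by
    refine le_of_mul_le_mul_right ?_ (hEpos (17 / 8))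
    rw [add_mul, mul_assoc, hEadd, hEadd]
    refine le_trans (le_of_eq ?_) (e1.trans ?_)
    · norm_num
    · gcongr
      simp only [hE]
      refine Real.exp_le_exp.2 ?_
      have : 0 ≤ L * l := by positivity
      nlinarith
  -- The angle at time `l` is of order `E (-3/8)`, while all later motion of both directions is at
  -- most of order `E (-15/8)`; hence the angle never closes.
  have e3 : (2 + C + D) * E (-(15 / 8)) < E (-(3 / 8)) := by
    calc _ < E (3 / 2) * E (-(15 / 8)) := mul_lt_mul_of_pos_right h7 (hEpos _)
      _ = _ := by rw [hEadd]; norm_num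
  have htail : Real.exp (-(2 * (15 / 16 * L)) * l) = E (-(15 / 8)) := by
    simp only [hE]
    congr 1
    ring
  rw [htail] at h1 h2
  refine ⟨|cross (t l) (s l)| - C * E (-(15 / 8)) - D * E (-(15 / 8)), by linarith, l,
    fun m hm j hj => ?_⟩
  have f1 := abs_cross_triangle (v := t l) (ht m).1 (hs l).1
  have f2 := abs_cross_triangle (v := t m) (hs j).1 (hs l).1
  rw [(ht l).1, one_mul] at f1
  rw [(ht m).1, one_mul, abs_cross_comm (s j)] at f2
  have := h1 j hj
  have := h2 m hm
  linarith

theorem exists_log_le (hX : HasGrowthRate X L) {ε : ℝ} (hε : 0 < ε) :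
    ∃ C : ℝ, ∀ l : ℕ, (L - ε) * l - C ≤ Real.log ‖slToCLM (X l)‖ := by
  obtain ⟨l₀, h⟩ := eventually_atTop.1 (hX.eventually_exp_le (show L - ε < L by linarith))
  refine ⟨|L - ε| * l₀, fun l => ?_⟩
  rcases le_total l₀ l with hl | hl
  · have h1 := (Real.le_log_iff_exp_le (norm_slToCLM_pos _)).2 (h l hl)
    have : 0 ≤ |L - ε| * l₀ := by positivity
    linarith
  · have h1 := log_norm_slToCLM_nonneg (X l)
    have h2 : (L - ε) * l ≤ |L - ε| * l := by gcongr; exact le_abs_self _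
    have h3 : |L - ε| * l ≤ |L - ε| * l₀ := by gcongr
    linarith

/-- Uniform lower bound for the growth of `X l * (Y m)⁻¹`. -/
theorem exists_log_mul_inv_ge (hX : HasGrowthRate X L) (hY : HasGrowthRate Y L) (hL : 0 < L)
    {K : ℝ} (hK : 0 ≤ K) (hXK : ∀ l : ℕ, Real.log ‖slToCLM (X l)‖ ≤ K * l)
    (hYK : ∀ l : ℕ, Real.log ‖slToCLM (Y l)‖ ≤ K * l)
    (h : ∃ᶠ l : ℕ in atTop, 7 / 4 * L * l ≤ Real.log ‖slToCLM (X l * (Y l)⁻¹)‖)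
    {ε : ℝ} (hε : 0 < ε) :
    ∃ C : ℝ, ∀ l m : ℕ, (L - ε) * (l + m) - C ≤ Real.log ‖slToCLM (X l * (Y m)⁻¹)‖ := by
  choose s hs using fun l => exists_isContracted (X l)
  choose t ht using fun l => exists_isContracted (Y l)
  obtain ⟨c, hc, l₀, hcl⟩ := hX.exists_le_abs_cross hY hL hs ht h
  obtain ⟨C, hC⟩ := hX.exists_log_le hε
  obtain ⟨D, hD⟩ := hY.exists_log_le hε
  have key : ∀ l m : ℕ, Real.log ‖slToCLM (X l)‖ + Real.log ‖slToCLM (Y m)‖ -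
      (|Real.log c| + 2 * K * l₀) ≤ Real.log ‖slToCLM (X l * (Y m)⁻¹)‖ := by
    intro l m
    have hk : 0 ≤ K * l₀ := by positivity
    have hac := abs_nonneg (Real.log c)
    have hx := hXK l
    have hy := hYK m
    have small : ∀ {i : ℕ}, i < l₀ → K * i ≤ K * l₀ := fun {i} hi => by
      have : (i : ℝ) ≤ l₀ := by exact_mod_cast hi.le
      gcongr
    -- Before `l₀` nothing is known about angles, but a short factor can cancel at most its own
    -- norm, at total cost `2 * K * l₀`.
    by_cases hl : l < l₀
    · have h1 := log_norm_slToCLM_right_le (X l) (Y m)⁻¹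
      rw [log_norm_slToCLM_inv] at h1
      have := small hl
      linarith
    by_cases hm : m < l₀
    · have h1 := log_norm_slToCLM_left_le (X l) (Y m)⁻¹
      rw [log_norm_slToCLM_inv] at h1
      have := small hm
      linarith
    have hXp := norm_slToCLM_pos (X l)
    have hYp := norm_slToCLM_pos (Y m)
    have h1 : c * (‖slToCLM (X l)‖ * ‖slToCLM (Y m)‖) ≤ ‖slToCLM (X l * (Y m)⁻¹)‖ :=
      le_trans (mul_le_mul_of_nonneg_right (hcl m (not_lt.1 hm) l (not_lt.1 hl)) (by positivity))
        ((hs l).mul_norm_le (ht m))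
    have h2 := Real.log_le_log (by positivity) h1
    rw [Real.log_mul hc.ne' (by positivity), Real.log_mul hXp.ne' hYp.ne'] at h2
    have := neg_abs_le (Real.log c)
    linarith
  refine ⟨C + D + (|Real.log c| + 2 * K * l₀), fun l m => ?_⟩
  have := key l m
  have := hC l
  have := hD m
  linarith

/-- No vector is contracted along both sequences. -/
theorem exists_tendsto_apply (hX : HasGrowthRate X L) (hY : HasGrowthRate Y L) (hL : 0 < L)
    (h : ∃ᶠ l : ℕ in atTop, 7 / 4 * L * l ≤ Real.log ‖slToCLM (X l * (Y l)⁻¹)‖)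
    {v : Plane} (hv : v ≠ 0) :
    ∃ Lp Lm : ℝ, Tendsto (fun l : ℕ => Real.log ‖slToCLM (X l) v‖ / l) atTop (𝓝 Lp) ∧
      Tendsto (fun l : ℕ => Real.log ‖slToCLM (Y l) v‖ / l) atTop (𝓝 Lm) ∧
      ¬ (Lp < 0 ∧ Lm < 0) := by
  choose s hs using fun l => exists_isContracted (X l)
  choose t ht using fun l => exists_isContracted (Y l)
  rcases hX.tendsto_apply hL hs hv with h1 | ⟨h1, h1'⟩ <;>
  rcases hY.tendsto_apply hL ht hv with h2 | ⟨h2, h2'⟩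
  · exact ⟨_, _, h1, h2, fun h => by linarith [h.1]⟩
  · exact ⟨_, _, h1, h2, fun h => by linarith [h.1]⟩
  · exact ⟨_, _, h1, h2, fun h => by linarith [h.2]⟩
  -- Both families of contracted directions would approach the line of `v`, contradicting their
  -- uniform transversality.
  · exfalso
    obtain ⟨c, hc, l₀, hcl⟩ := hX.exists_le_abs_cross hY hL hs ht h
    have hv0 : 0 < ‖v‖ := norm_pos_iff.2 hv
    have hlim : Tendsto (fun l => |cross v (t l)| + |cross v (s l)|) atTop (𝓝 0) := by
      simpa using h2'.add h1'
    obtain ⟨l, h3, h4⟩ := ((hlim.eventually_lt_const (show 0 < ‖v‖ * c by positivity)).and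
      (eventually_ge_atTop l₀)).exists
    have h5 := norm_mul_abs_cross_le v (t l) (s l)
    rw [(ht l).1, (hs l).1, mul_one, one_mul, abs_cross_comm (t l) v] at h5
    have h6 := mul_le_mul_of_nonneg_left (hcl l h4 l h4) hv0.le
    linarith

end HasGrowthRate

/-! ## Growth of almost additive functions of words -/

/-- `G ω t n` is a subadditive quantity attached to the word `ω(t) … ω(t+n-1)`; it depends on this
word only up to the constant `C`. -/
structure IsWordCost {A : Type*} [TopologicalSpace A] (Ω : Subshift A)
    (G : Ω.carrier → ℤ → ℕ → ℝ) (K C : ℝ) : Prop where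
  K_nonneg : 0 ≤ K
  C_nonneg : 0 ≤ C
  nonneg : ∀ (ω : Ω.carrier) (t : ℤ) (n : ℕ), 0 ≤ G ω t n
  le_mul : ∀ (ω : Ω.carrier) (t : ℤ) (n : ℕ), G ω t n ≤ K * n
  add_le : ∀ (ω : Ω.carrier) (t : ℤ) (n m : ℕ), G ω t (n + m) ≤ G ω t n + G ω (t + n) m
  left_le : ∀ (ω : Ω.carrier) (t : ℤ) (n m : ℕ), G ω t n ≤ G ω t (n + m) + G ω (t + n) m
  right_le : ∀ (ω : Ω.carrier) (t : ℤ) (n m : ℕ), G ω (t + n) m ≤ G ω t (n + m) + G ω t n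
  congr : ∀ (ω ρ : Ω.carrier) (t s : ℤ) (n : ℕ),
    (∀ i < n, ω.1 (t + (i : ℕ)) = ρ.1 (s + (i : ℕ))) → G ω t n ≤ G ρ s n + C

namespace ToeplitzCoding

variable {A : Type*} (c : ToeplitzCoding A)

theorem leadingSeq_congr (x y : A) {s t : ℤ} {k : ℕ} (ht : ¬ (c.period k : ℤ) ∣ t)
    (h : (c.period k : ℤ) ∣ s - t) : c.leadingSeq x s = c.leadingSeq y t := by
  have ht0 : t ≠ 0 := by rintro rfl; simp at ht
  have hs0 : s ≠ 0 := by
    rintro rfl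
    rw [zero_sub, dvd_neg] at h
    exact ht h
  rw [c.leadingSeq_of_ne x hs0, c.leadingSeq_of_ne y ht0, c.level_congr ht h]

theorem leadingSeq_add_eq (x y : A) {k : ℕ} {q t : ℤ} (hq : (c.period k : ℤ) ∣ q)
    (ht : ¬ (c.period (k + 1) : ℤ) ∣ t) (hqt : ¬ (c.period (k + 1) : ℤ) ∣ q + t) :
    c.leadingSeq x (q + t) = c.leadingSeq y t := by
  have ht0 : t ≠ 0 := by rintro rfl; simp at ht
  have hs0 : q + t ≠ 0 := by
    intro h
    rw [h] at hqt
    simp at hqt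
  rw [c.leadingSeq_of_ne x hs0, c.leadingSeq_of_ne y ht0, c.level_add_eq hq ht hqt]

theorem tendsto_period : Tendsto (fun k => (c.period k : ℝ)) atTop atTop :=
  tendsto_natCast_atTop_atTop.comp c.period_strictMono.tendsto_atTop

/-- Every length lies between two consecutive periods. -/
theorem exists_period_le {k₀ n : ℕ} (hn : c.period k₀ ≤ n) :
    ∃ k ≥ k₀, ∃ m, 1 ≤ m ∧ m + 1 ≤ c.n k ∧ c.period k * m ≤ n ∧ n < c.period k * (m + 1) := by
  classical
  have hex : ∃ k, n < c.period k := ⟨n, c.lt_period n⟩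
  have hlt := Nat.find_spec hex
  have hpos : k₀ < Nat.find hex := by
    by_contra! h
    have := c.period_strictMono.monotone h
    omega
  obtain ⟨k, hk⟩ : ∃ k, Nat.find hex = k + 1 := ⟨Nat.find hex - 1, by omega⟩
  have hle : c.period k ≤ n := by
    have := Nat.find_min hex (m := k) (by omega)
    omega
  rw [hk, period_succ] at hlt
  have hP := c.period_pos k
  refine ⟨k, by omega, n / c.period k, (Nat.one_le_div_iff hP).2 hle, ?_, Nat.mul_div_le _ _,
    Nat.lt_mul_div_succ n hP⟩
  exact Nat.div_lt_of_lt_mul hlt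

end ToeplitzCoding

/-! ### Growth rate of word costs over a simple Toeplitz subshift. -/

namespace IsWordCost

open ToeplitzCoding

variable {A : Type*} [TopologicalSpace A] [DiscreteTopology A] {c : ToeplitzCoding A}
  {G : c.subshift.carrier → ℤ → ℕ → ℝ} {K C : ℝ}

/-- Intended for a block followed by a hole: only the last letter may differ, and removing it on
each side costs `K`. -/
theorem le_of_eq_init (hG : IsWordCost c.subshift G K C) {ω ρ : c.subshift.carrier} {t s : ℤ}
    {n : ℕ} (h : ∀ i, i + 1 < n → ω.1 (t + (i : ℕ)) = ρ.1 (s + (i : ℕ))) :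
    G ω t n ≤ G ρ s n + (C + 2 * K) := by
  have hK := hG.K_nonneg
  have hC := hG.C_nonneg
  rcases n with _ | n
  · have := hG.le_mul ω t 0
    have := hG.nonneg ρ s 0
    simp at *
    linarith
  · have h1 := hG.congr ω ρ t s n fun i hi => h i (by omega)
    have h2 := hG.add_le ω t n 1
    have h3 := hG.left_le ρ s n 1
    have h4 := hG.le_mul ω (t + n) 1
    have h5 := hG.le_mul ρ (s + n) 1
    simp only [Nat.cast_one, mul_one] at h4 h5
    linarith

variable (x : {x : A | ∃ᶠ k in atTop, c.a k = x})

/-- After a multiple of `period k` the sequence reads `block k`, hole, `block k`, hole, and so on,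
with only the hole letters varying. -/
theorem skeleton_le (hG : IsWordCost c.subshift G K C) (k : ℕ) {t : ℤ}
    (ht : (c.period k : ℤ) ∣ t) (m : ℕ) :
    G (c.leadingPoint x) (t + 1) (c.period k * m) ≤
      m * (G (c.leadingPoint x) 1 (c.period k) + (C + 2 * K)) := by
  induction m with
  | zero => simpa using hG.le_mul (c.leadingPoint x) (t + 1) 0
  | succ m ih =>
    have h1 := hG.add_le (c.leadingPoint x) (t + 1) (c.period k * m) (c.period k)
    have h2 : G (c.leadingPoint x) (t + 1 + (c.period k * m : ℕ)) (c.period k) ≤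
        G (c.leadingPoint x) 1 (c.period k) + (C + 2 * K) := by
      refine hG.le_of_eq_init fun i hi => c.leadingSeq_congr x.1 x.1 (k := k) ?_ ?_
      · apply c.not_period_dvd_of_abs_lt (by omega)
        rw [abs_of_pos (by omega)]
        omega
      · have : t + 1 + ((c.period k * m : ℕ) : ℤ) + i - (1 + i) = t + c.period k * m := by
          push_cast
          ring
        rw [this]
        exact dvd_add ht (Dvd.intro _ rfl)
    rw [mul_add_one]
    push_cast
    linarith

/-- Inside `block (k + 1)` all separators are the same letter `a_k`, so a prefix of `m` periods
repeats `q` times, except possibly for the hole at the very end. -/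
theorem prefix_mul_le (hG : IsWordCost c.subshift G K C) (k m q : ℕ)
    (hq : q * m ≤ c.n k) :
    G (c.leadingPoint x) 1 (c.period k * m * q) ≤
      q * (G (c.leadingPoint x) 1 (c.period k * m) + (C + 2 * K)) := by
  have hP := c.period_pos k
  induction q with
  | zero => simpa using hG.le_mul (c.leadingPoint x) 1 0
  | succ q ih =>
    have ih' := ih (le_trans (Nat.mul_le_mul_right _ (Nat.le_succ q)) hq)
    have h1 := hG.add_le (c.leadingPoint x) 1 (c.period k * m * q) (c.period k * m)
    have hle : c.period k * m * q + c.period k * m ≤ c.period (k + 1) := by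
      rw [period_succ]
      calc _ = c.period k * ((q + 1) * m) := by ring
        _ ≤ _ := Nat.mul_le_mul_left _ hq
    have h2 : G (c.leadingPoint x) (1 + (c.period k * m * q : ℕ)) (c.period k * m) ≤
        G (c.leadingPoint x) 1 (c.period k * m) + (C + 2 * K) := by
      refine hG.le_of_eq_init fun i hi => ?_
      have e : (1 : ℤ) + (c.period k * m * q : ℕ) + i
          = (c.period k * m * q : ℕ) + (1 + i) := by ring
      rw [e]
      refine c.leadingSeq_add_eq x.1 x.1 (k := k) ?_ ?_ ?_
      · exact Int.natCast_dvd_natCast.2 ⟨m * q, by ring⟩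
      · apply c.not_period_dvd_of_abs_lt (by omega)
        rw [abs_of_pos (by omega)]
        omega
      · apply c.not_period_dvd_of_abs_lt (by omega)
        rw [abs_of_pos (by omega)]
        omega
    rw [mul_add_one]
    push_cast
    linarith

/-- The growth rate along the blocks. -/
theorem exists_block_rate (hG : IsWordCost c.subshift G K C) :
    ∃ L : ℝ, 0 ≤ L ∧
      (∀ k, L * c.period k ≤ G (c.leadingPoint x) 1 (c.period k) + 2 * (C + 2 * K)) ∧
      ∀ ε > 0, ∀ᶠ k in atTop,
        G (c.leadingPoint x) 1 (c.period k) + (C + 2 * K) ≤ (L + ε) * c.period k := by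
  have hK := hG.K_nonneg
  have hC := hG.C_nonneg
  have hP : ∀ k, (0 : ℝ) < c.period k := fun k => by exact_mod_cast c.period_pos k
  set d : ℕ → ℝ := fun k => G (c.leadingPoint x) 1 (c.period k) with hd
  -- The correction is twice the cost per copy: as `n_k ≥ 2`, this surplus makes the corrected
  -- averages decrease, so their infimum is their limit.
  set e : ℕ → ℝ := fun k => (d k + 2 * (C + 2 * K)) / c.period k with he
  have hd0 : ∀ k, 0 ≤ d k := fun k => hG.nonneg _ _ _
  have he0 : ∀ k, 0 ≤ e k := fun k => div_nonneg (by linarith [hd0 k]) (hP k).le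
  have hanti : Antitone e := by
    refine antitone_nat_of_succ_le fun k => ?_
    have h1 := hG.skeleton_le x k (dvd_zero _) (c.n k)
    rw [zero_add, ← period_succ] at h1
    have h2 : (2 : ℝ) ≤ c.n k := by exact_mod_cast c.two_le_n k
    simp only [he]
    rw [div_le_div_iff₀ (hP _) (hP _), period_succ]
    push_cast
    have h3 : d (k + 1) + 2 * (C + 2 * K) ≤ c.n k * (d k + 2 * (C + 2 * K)) := by
      have h4 : (2 : ℝ) * (C + 2 * K) ≤ c.n k * (C + 2 * K) := by gcongr
      have : d (k + 1) ≤ c.n k * (d k + (C + 2 * K)) := h1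
      linarith
    calc _ ≤ (c.n k * (d k + 2 * (C + 2 * K))) * (c.period k : ℝ) := by
          gcongr
      _ = _ := by ring
  have hbdd : BddBelow (Set.range e) := ⟨0, by rintro _ ⟨k, rfl⟩; exact he0 k⟩
  refine ⟨⨅ k, e k, le_ciInf he0, fun k => ?_, fun ε hε => ?_⟩
  · rw [← le_div_iff₀ (hP k)]
    exact ciInf_le hbdd k
  · filter_upwards [(tendsto_atTop_ciInf hanti hbdd).eventually_le_const
      (show (⨅ k, e k) < (⨅ k, e k) + ε by linarith)] with k hk
    rw [div_le_iff₀ (hP k)] at hk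
    linarith

/-- The conclusion of the growth estimates: uniform upper bounds, and lower bounds for the words
next to the origin of a leading sequence. -/
theorem exists_rate (hG : IsWordCost c.subshift G K C) :
    ∃ L : ℝ, 0 ≤ L ∧
      (∀ ε > 0, ∃ D, ∀ ω t n, G ω t n ≤ (L + ε) * n + D) ∧
      (∀ ε > 0, ∃ D, ∀ x (n : ℕ), (L - ε) * n - D ≤ G (c.leadingPoint x) 1 n) ∧
      (∀ ε > 0, ∃ D, ∀ x (n : ℕ), (L - ε) * n - D ≤ G (c.leadingPoint x) (-n) n) := by
  have hK := hG.K_nonneg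
  have hC := hG.C_nonneg
  obtain ⟨x₀, hx₀⟩ := c.eventual_nontrivial.nonempty
  set x : {x : A | ∃ᶠ k in atTop, c.a k = x} := ⟨x₀, hx₀⟩
  obtain ⟨L, hL, hlow, hup⟩ := hG.exists_block_rate x
  have hP : ∀ k, (0 : ℝ) < c.period k := fun k => by exact_mod_cast c.period_pos k
  -- Cut a word into an initial piece up to a hole of level at least `k`, full periods, and a
  -- remainder; both end pieces are shorter than `period k`.
  have upper : ∀ ε > 0, ∃ D, 0 ≤ D ∧ ∀ ω t n, G ω t n ≤ (L + ε) * n + D := by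
    intro ε hε
    obtain ⟨k, hk⟩ := (hup ε hε).exists
    have hPk := hP k
    have main : ∀ t n, G (c.leadingPoint x) t n ≤ (L + ε) * n + 2 * K * c.period k := by
      intro t n
      obtain ⟨i, hi, hd⟩ := c.exists_dvd_add k (t - 1)
      have hi' : (i : ℝ) ≤ c.period k := by exact_mod_cast hi.le
      have hKi : K * i ≤ K * c.period k := by gcongr
      rcases le_total n i with hn | hn
      · have h1 := hG.le_mul (c.leadingPoint x) t n
        have h2 : K * n ≤ K * i := by gcongr
        have : 0 ≤ (L + ε) * n := by positivity
        have : 0 ≤ K * c.period k := by positivity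
        linarith
      · obtain ⟨m, r, hr, hmr⟩ : ∃ m r, r < c.period k ∧ n = i + (c.period k * m + r) :=
          ⟨(n - i) / c.period k, (n - i) % c.period k, Nat.mod_lt _ (c.period_pos k), by
            rw [Nat.div_add_mod]; omega⟩
        have h1 := hG.add_le (c.leadingPoint x) t i (c.period k * m + r)
        have h2 := hG.add_le (c.leadingPoint x) (t + i) (c.period k * m) r
        have h3 := hG.skeleton_le x k hd m
        rw [show t - 1 + i + 1 = t + i by ring] at h3
        have h4 := hG.le_mul (c.leadingPoint x) t i
        have h5 := hG.le_mul (c.leadingPoint x) (t + i + (c.period k * m : ℕ)) r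
        have hr' : (r : ℝ) ≤ c.period k := by exact_mod_cast hr.le
        have hKr : K * r ≤ K * c.period k := by gcongr
        have h6 : (m : ℝ) * (G (c.leadingPoint x) 1 (c.period k) + (C + 2 * K)) ≤
            m * ((L + ε) * c.period k) := by gcongr
        have h7 : (m : ℝ) * ((L + ε) * c.period k) ≤ (L + ε) * n := by
          have : (m : ℝ) * c.period k ≤ n := by
            rw [hmr]
            push_cast
            nlinarith [(Nat.cast_nonneg i : (0 : ℝ) ≤ i), (Nat.cast_nonneg r : (0 : ℝ) ≤ r)]
          calc _ = (L + ε) * (m * c.period k) := by ring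
            _ ≤ _ := by gcongr
        rw [← hmr] at h1
        linarith
    refine ⟨2 * K * c.period k + C, by positivity, fun ω t n => ?_⟩
    obtain ⟨m, hm⟩ := (c.mem_toeplitzSet_iff ω.1).1 ω.2 t n
    have h1 := hG.congr ω (c.leadingPoint x) t (m + 1) n fun i hi => by
      rw [hm i hi]
      exact (c.leadingSeq_of_ne _ (by omega)).symm
    have := main (m + 1) n
    linarith
  have blocks : ∀ ε > 0, ∀ᶠ k in atTop, ∀ m, 1 ≤ m → m ≤ c.n k →
      (L - ε) * (c.period k * m : ℕ) ≤ G (c.leadingPoint x) 1 (c.period k * m) := by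
    intro ε hε
    filter_upwards [hup (ε / 2) (by linarith),
      c.tendsto_period.eventually_ge_atTop (3 * (C + 2 * K) / (ε / 2))] with k hk hk2 m hm hmn
    rw [div_le_iff₀ (by linarith)] at hk2
    -- `block (k + 1)` with its final hole is `q` copies of the prefix and `r < m` further periods.
    -- If the prefix grew too slowly, the whole would violate `hlow (k + 1)`; the error from the
    -- remainder is absorbed since `r < m ≤ q * m`.
    obtain ⟨q, r, hr, hqr⟩ : ∃ q r, r < m ∧ c.n k = q * m + r :=
      ⟨c.n k / m, c.n k % m, Nat.mod_lt _ hm, by rw [mul_comm, Nat.div_add_mod]⟩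
    have hq : 1 ≤ q := by
      rcases Nat.eq_zero_or_pos q with rfl | h
      · omega
      · exact h
    have h1 := hG.prefix_mul_le x k m q (by omega)
    have h2 := hG.skeleton_le x k (t := (c.period k * m * q : ℕ))
      (Int.natCast_dvd_natCast.2 ⟨m * q, by ring⟩) r
    have h3 := hG.add_le (c.leadingPoint x) 1 (c.period k * m * q) (c.period k * r)
    rw [show c.period k * m * q + c.period k * r = c.period (k + 1) by
      rw [period_succ, hqr]; ring, add_comm (1 : ℤ)] at h3
    have h4 := hlow (k + 1)
    have h5 : (r : ℝ) * (G (c.leadingPoint x) 1 (c.period k) + (C + 2 * K)) ≤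
        r * ((L + ε / 2) * c.period k) := by gcongr
    have h6 : (c.period (k + 1) : ℝ) = c.period k * (q * m + r) := by
      rw [period_succ, hqr]
      push_cast
      ring
    rw [h6] at h4
    have hq' : (1 : ℝ) ≤ q := by exact_mod_cast hq
    have hr' : (r : ℝ) ≤ m := by exact_mod_cast hr.le
    have hm' : (1 : ℝ) ≤ m := by exact_mod_cast hm
    set g := G (c.leadingPoint x) 1 (c.period k * m)
    set P := (c.period k : ℝ)
    have hPk : 0 < P := hP k
    have h7 : L * P * (q * m) ≤ q * g + q * (3 * (C + 2 * K)) + m * (ε / 2 * P) := by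
      have a1 : 2 * (C + 2 * K) ≤ q * (2 * (C + 2 * K)) := by
        have : 0 ≤ 2 * (C + 2 * K) := by positivity
        nlinarith
      have a2 : r * (ε / 2 * P) ≤ m * (ε / 2 * P) := by gcongr
      linarith
    have h8 : q * (3 * (C + 2 * K)) + m * (ε / 2 * P) ≤ q * (ε * (P * m)) := by
      have a1 : 3 * (C + 2 * K) ≤ ε / 2 * P * m := by nlinarith
      have a2 : q * (3 * (C + 2 * K)) ≤ q * (ε / 2 * P * m) := by gcongr
      have a3 : m * (ε / 2 * P) ≤ q * (m * (ε / 2 * P)) := by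
        have : 0 ≤ m * (ε / 2 * P) := by positivity
        nlinarith
      linarith
    have h9 : (q : ℝ) * ((L - ε) * (P * m)) ≤ q * g := by linarith
    push_cast
    exact le_of_mul_le_mul_left h9 (by linarith)
  -- Extend a word of length `n` to a full prefix of `m + 1` periods; the long prefix is expensive
  -- and the added piece is not. The bound `b` and the added piece `(ω, t)` stay free so that both
  -- sides of the origin are covered.
  have lower : ∀ ε > 0, ∃ D, 0 ≤ D ∧ ∀ n : ℕ, 0 ≤ (L - ε) * n - D → ∃ k m : ℕ,
      m + 1 ≤ c.n k ∧ n < c.period k * (m + 1) ∧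
      ∀ (ω : c.subshift.carrier) (t : ℤ) (b : ℝ),
        G (c.leadingPoint x) 1 (c.period k * (m + 1)) ≤ b + C + K +
          G ω t (c.period k * (m + 1) - 1 - n) → (L - ε) * n - D ≤ b := by
    intro ε hε
    obtain ⟨D, hD, hDup⟩ := upper (ε / 4) (by linarith)
    obtain ⟨k₀, hk₀⟩ := eventually_atTop.1 (blocks (ε / 4) (by linarith))
    -- The summand `L * period k₀ + 1` makes the claimed lower bound negative for `n < period k₀`.
    refine ⟨D + C + K + L * c.period k₀ + 1, by have := (hP k₀).le; positivity, fun n hn => ?_⟩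
    have hn' : c.period k₀ ≤ n := by
      by_contra! h
      have h1 : (n : ℝ) < c.period k₀ := by exact_mod_cast h
      have h2 : L * n ≤ L * c.period k₀ := by gcongr
      have h3 : 0 ≤ ε * n := by positivity
      linarith
    obtain ⟨k, hk, m, hm1, hmn, hle, hlt⟩ := c.exists_period_le hn'
    refine ⟨k, m, hmn, hlt, fun ω t b hb => ?_⟩
    have h1 := hk₀ k hk (m + 1) (by omega) hmn
    have h2 := hDup ω t (c.period k * (m + 1) - 1 - n)
    have h3 : ((c.period k * (m + 1) - 1 - n : ℕ) : ℝ) ≤ (c.period k * (m + 1) : ℕ) - n := by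
      rw [← Nat.cast_sub hlt.le]
      exact_mod_cast (by omega)
    -- This holds since `m ≥ 1`. The prefix and the added piece of length at most `n` then
    -- contribute an error of at most `3ε/4 * n`.
    have h4 : ((c.period k * (m + 1) : ℕ) : ℝ) ≤ 2 * n := by
      have : c.period k * (m + 1) ≤ 2 * (c.period k * m) := by nlinarith
      exact_mod_cast this.trans (by omega)
    have h5 : (L + ε / 4) * ((c.period k * (m + 1) - 1 - n : ℕ) : ℝ) ≤
        (L + ε / 4) * ((c.period k * (m + 1) : ℕ) - n) := by gcongr
    have h6 : 0 ≤ L * c.period k₀ := by have := (hP k₀).le; positivity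
    nlinarith
  refine ⟨L, hL, fun ε hε => (upper ε hε).imp fun D h => h.2, fun ε hε => ?_, fun ε hε => ?_⟩
  · obtain ⟨D, hD, hl⟩ := lower ε hε
    refine ⟨D, fun y n => ?_⟩
    rcases lt_or_ge ((L - ε) * n - D) 0 with h0 | h0
    · exact h0.le.trans (hG.nonneg _ _ _)
    obtain ⟨k, m, hmn, hlt, h⟩ := hl n h0
    refine h (c.leadingPoint x) (1 + n) _ ?_
    have e : c.period k * (m + 1) = n + (c.period k * (m + 1) - 1 - n) + 1 := by omega
    have h1 := hG.add_le (c.leadingPoint x) 1 (n + (c.period k * (m + 1) - 1 - n)) 1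
    rw [← e] at h1
    have h2 := hG.add_le (c.leadingPoint x) 1 n (c.period k * (m + 1) - 1 - n)
    have h3 := hG.le_mul (c.leadingPoint x) (1 + (n + (c.period k * (m + 1) - 1 - n) : ℕ)) 1
    have h4 := hG.congr (c.leadingPoint x) (c.leadingPoint y) 1 1 n fun i hi =>
      (c.leadingSeq_of_ne _ (by omega)).trans (c.leadingSeq_of_ne _ (by omega)).symm
    rw [Nat.cast_one, mul_one] at h3
    linarith
  · obtain ⟨D, hD, hl⟩ := lower ε hε
    refine ⟨D, fun y n => ?_⟩
    rcases lt_or_ge ((L - ε) * n - D) 0 with h0 | h0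
    · exact h0.le.trans (hG.nonneg _ _ _)
    obtain ⟨k, m, hmn, hlt, h⟩ := hl n h0
    set N := c.period k * (m + 1) with hN
    have hNP : N ≤ c.period (k + 1) := by
      rw [hN, period_succ]
      exact Nat.mul_le_mul_left _ hmn
    refine h (c.leadingPoint y) (-N + 1) _ ?_
    have h1 := hG.add_le (c.leadingPoint x) 1 (N - 1) 1
    rw [Nat.sub_add_cancel (by omega)] at h1
    -- Translation by `N`, at most `period (k + 1)`, carries the positions `-N + 1, …, -1` to `1, …,
    -- N - 1` without meeting a hole of level above `k`; the letter at `N` is given up.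
    have h2 := hG.congr (c.leadingPoint x) (c.leadingPoint y) 1 (-N + 1) (N - 1) fun i hi => by
      rw [add_assoc]
      refine (c.leadingSeq_add_eq y.1 x.1 (k := k) ?_ ?_ ?_).symm
      · rw [dvd_neg, hN]
        exact Int.natCast_dvd_natCast.2 ⟨m + 1, by ring⟩
      · apply c.not_period_dvd_of_abs_lt (by omega)
        rw [abs_of_pos (by omega)]
        omega
      · apply c.not_period_dvd_of_abs_lt (by omega)
        rw [abs_of_neg (by omega)]
        omega
    have h3 := hG.le_mul (c.leadingPoint x) (1 + (N - 1 : ℕ)) 1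
    have h4 := hG.add_le (c.leadingPoint y) (-N + 1) (N - 1 - n) n
    rw [show N - 1 - n + n = N - 1 by omega,
      show (-N + 1 + (N - 1 - n : ℕ) : ℤ) = -n by omega] at h4
    rw [Nat.cast_one, mul_one] at h3
    linarith

end IsWordCost

/-! ## Cocycles over subshifts -/

section Cocycle

variable {X : Type*} (T : Equiv.Perm X) (M : X → SL2)

theorem cocycleForward_add (n m : ℕ) (x : X) :
    cocycleForward T M (n + m) x = cocycleForward T M m ((T ^ n) x) * cocycleForward T M n x := by
  induction m with
  | zero => simp [cocycleForward]
  | succ m ih =>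
    rw [← add_assoc, cocycleForward, ih, cocycleForward, mul_assoc, ← Equiv.Perm.mul_apply,
      ← pow_add, add_comm n m]

theorem cocycleForward_one (x : X) : cocycleForward T M 1 x = M x := by
  simp [cocycleForward]

theorem cocycleForward_congr {n : ℕ} {x y : X} (h : ∀ i < n, M ((T ^ i) x) = M ((T ^ i) y)) :
    cocycleForward T M n x = cocycleForward T M n y := by
  induction n with
  | zero => rfl
  | succ n ih =>
    rw [cocycleForward, cocycleForward, h n (Nat.lt_succ_self n),
      ih fun i hi => h i (Nat.lt_succ_of_lt hi)]

theorem cocycleBackward_eq (n : ℕ) (x : X) :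
    cocycleBackward T M n x = (cocycleForward T M n ((T ^ (-(n : ℤ))) x))⁻¹ := by
  induction n with
  | zero => simp [cocycleBackward, cocycleForward]
  | succ n ih =>
    have e1 : (T ^ 1) ((T ^ (-((n + 1 : ℕ) : ℤ))) x) = (T ^ (-(n : ℤ))) x := by
      rw [← Equiv.Perm.mul_apply, ← zpow_natCast, ← zpow_add]
      congr 2
      push_cast
      ring
    have e2 : (T⁻¹ ^ (n + 1)) x = (T ^ (-((n + 1 : ℕ) : ℤ))) x := by
      rw [zpow_neg, zpow_natCast, inv_pow]
    rw [cocycleBackward, ih, add_comm n 1, cocycleForward_add, mul_inv_rev, cocycleForward_one,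
      add_comm 1 n, e1, e2]

/-- Turns products of the form `X l * (Y m)⁻¹` into the cocycle over the window from `-m` to `l -
1`. -/
theorem cocycleForward_mul_inv (l m : ℕ) (x : X) :
    cocycleForward T M l x * (cocycleBackward T M m x)⁻¹ =
      cocycleForward T M (m + l) ((T ^ (-(m : ℤ))) x) := by
  rw [cocycleBackward_eq, inv_inv, cocycleForward_add, ← Equiv.Perm.mul_apply, ← zpow_natCast,
    ← zpow_add, add_neg_cancel, zpow_zero, Equiv.Perm.one_apply]

theorem cocycle_natCast (n : ℕ) (x : X) : cocycle T M n x = cocycleForward T M n x := by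
  simp [cocycle]

theorem cocycle_neg_natCast (n : ℕ) (x : X) : cocycle T M (-n) x = cocycleBackward T M n x := by
  rcases n with _ | n
  · simp [cocycle, cocycleForward, cocycleBackward]
  · rw [cocycle, if_neg (by omega), neg_neg, Int.toNat_natCast]

end Cocycle

namespace Subshift

variable {A : Type*} [TopologicalSpace A] (Ω : Subshift A)

theorem T_apply (ω : Ω.carrier) (i : ℤ) : (Ω.T ω).1 i = ω.1 (i + 1) := rfl

theorem T_inv_apply (ω : Ω.carrier) (i : ℤ) : (Ω.T⁻¹ ω).1 i = ω.1 (i - 1) := by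
  have h := Ω.T_apply (Ω.T⁻¹ ω) (i - 1)
  have h' : Ω.T (Ω.T⁻¹ ω) = ω := Ω.T.apply_symm_apply ω
  rw [h', sub_add_cancel] at h
  exact h.symm

theorem T_zpow_apply (t : ℤ) (ω : Ω.carrier) (i : ℤ) : ((Ω.T ^ t) ω).1 i = ω.1 (i + t) := by
  induction t generalizing i with
  | zero => simp
  | succ n ih => rw [add_comm, zpow_add, zpow_one, Equiv.Perm.mul_apply, T_apply, ih, add_assoc]
  | pred n ih =>
    rw [sub_eq_add_neg, add_comm, zpow_add, zpow_neg_one, Equiv.Perm.mul_apply, T_inv_apply, ih]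
    exact congrArg ω.1 (by ring)

variable {Ω}

theorem IsLocConst.finite_range [Finite A] {Y : Type*} {f : Ω.carrier → Y}
    (hf : Ω.IsLocConst f) : (Set.range f).Finite := by
  obtain ⟨N, hN⟩ := hf
  let restr : Ω.carrier → (Finset.Icc (-(N : ℤ)) N → A) := fun ω i => ω.1 i
  have hfac : Function.FactorsThrough f restr := fun ω ρ h => hN ω ρ fun i hi hi' =>
    congrFun h ⟨i, Finset.mem_Icc.2 ⟨hi, hi'⟩⟩
  rcases isEmpty_or_nonempty Y with hY | ⟨⟨y⟩⟩
  · exact Set.toFinite _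
  · refine (Set.finite_range (Function.extend restr f fun _ => y)).subset ?_
    rintro _ ⟨ω, rfl⟩
    exact ⟨restr ω, hfac.extend_apply _ ω⟩

/-- The logarithmic norm of the cocycle over the word of length `n` at position `t`. -/
noncomputable def logNorm (M : Ω.carrier → SL2) (ω : Ω.carrier) (t : ℤ) (n : ℕ) : ℝ :=
  Real.log ‖slToCLM (cocycleForward Ω.T M n ((Ω.T ^ t) ω))‖

theorem T_pow_zpow (t : ℤ) (n : ℕ) (ω : Ω.carrier) :
    (Ω.T ^ n) ((Ω.T ^ t) ω) = (Ω.T ^ (t + n)) ω := by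
  rw [← Equiv.Perm.mul_apply, ← zpow_natCast, ← zpow_add, add_comm]

theorem logNorm_congr {M : Ω.carrier → SL2} {N : ℕ}
    (hN : ∀ ω ρ : Ω.carrier, (∀ i : ℤ, -(N : ℤ) ≤ i → i ≤ N → ω.1 i = ρ.1 i) → M ω = M ρ)
    {ω ρ : Ω.carrier} {t s : ℤ} {n : ℕ}
    (h : ∀ i < N + n + N, ω.1 (t + (i : ℕ)) = ρ.1 (s + (i : ℕ))) :
    logNorm M ω (t + N) n = logNorm M ρ (s + N) n := by
  unfold logNorm
  congr 3
  refine cocycleForward_congr _ _ fun j hj => hN _ _ fun i hi hi' => ?_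
  rw [T_pow_zpow, T_pow_zpow, T_zpow_apply, T_zpow_apply]
  have := h (i + N + j).toNat (by omega)
  rw [Int.toNat_of_nonneg (by omega)] at this
  convert this using 2 <;> ring

theorem exists_isWordCost [Finite A] {M : Ω.carrier → SL2} (hM : Ω.IsLocConst M) :
    ∃ K C, (∀ ω, Real.log ‖slToCLM (M ω)‖ ≤ K) ∧ IsWordCost Ω (logNorm M) K C := by
  obtain ⟨K₀, hK₀⟩ := (hM.finite_range.image fun B => Real.log ‖slToCLM B‖).bddAbove
  obtain ⟨N, hN⟩ := hM
  have hK : ∀ ω, Real.log ‖slToCLM (M ω)‖ ≤ max K₀ 0 := fun ω =>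
    (hK₀ ⟨_, ⟨ω, rfl⟩, rfl⟩).trans (le_max_left _ _)
  set K := max K₀ 0
  have hK0 : 0 ≤ K := le_max_right _ _
  have nonneg : ∀ (ω : Ω.carrier) (t : ℤ) (n : ℕ), 0 ≤ logNorm M ω t n :=
    fun ω t n => log_norm_slToCLM_nonneg _
  have le_mul : ∀ (ω : Ω.carrier) (t : ℤ) (n : ℕ), logNorm M ω t n ≤ K * n := by
    intro ω t n
    induction n with
    | zero => simp [logNorm, cocycleForward, slToCLM_one]
    | succ n ih =>
      refine (log_norm_slToCLM_mul_le _ _).trans ?_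
      have := hK ((Ω.T ^ n) ((Ω.T ^ t) ω))
      rw [logNorm] at ih
      rw [Nat.cast_succ]
      linarith
  have split : ∀ (ω : Ω.carrier) (t : ℤ) (n m : ℕ),
      cocycleForward Ω.T M (n + m) ((Ω.T ^ t) ω) =
        cocycleForward Ω.T M m ((Ω.T ^ (t + n)) ω) *
          cocycleForward Ω.T M n ((Ω.T ^ t) ω) := fun ω t n m => by
    rw [cocycleForward_add, T_pow_zpow]
  have add_le : ∀ (ω : Ω.carrier) (t : ℤ) (n m : ℕ),
      logNorm M ω t (n + m) ≤ logNorm M ω t n + logNorm M ω (t + n) m := by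
    intro ω t n m
    unfold logNorm
    rw [split, add_comm (Real.log _)]
    exact log_norm_slToCLM_mul_le _ _
  have left_le : ∀ (ω : Ω.carrier) (t : ℤ) (n m : ℕ),
      logNorm M ω t n ≤ logNorm M ω t (n + m) + logNorm M ω (t + n) m := by
    intro ω t n m
    unfold logNorm
    rw [split]
    exact log_norm_slToCLM_right_le _ _
  have right_le : ∀ (ω : Ω.carrier) (t : ℤ) (n m : ℕ),
      logNorm M ω (t + n) m ≤ logNorm M ω t (n + m) + logNorm M ω t n := by
    intro ω t n m
    unfold logNorm
    rw [split]
    exact log_norm_slToCLM_left_le _ _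
  -- Matrices within `N` of either end depend on letters outside the word; trimming both ends of
  -- both words costs `4 * K * N`.
  refine ⟨K, 4 * K * N, hK, hK0, by positivity, nonneg, le_mul, add_le, left_le, right_le,
    fun ω ρ t s n h => ?_⟩
  rcases lt_or_ge n (N + N) with hn | hn
  · have h1 := le_mul ω t n
    have h2 : K * n ≤ K * (N + N) := by
      gcongr
      exact_mod_cast hn.le
    have := nonneg ρ s n
    have : 0 ≤ K * N := by positivity
    linarith
  · obtain ⟨k, rfl⟩ : ∃ k, n = N + (k + N) := ⟨n - (N + N), by omega⟩
    have h1 := add_le ω t N (k + N)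
    have h2 := add_le ω (t + N) k N
    have h3 := right_le ρ s N (k + N)
    have h4 := left_le ρ (s + N) k N
    have h5 := logNorm_congr hN (n := k) (t := t) (s := s) (ω := ω) (ρ := ρ)
      fun i hi => h i (by omega)
    have h6 := le_mul ω t N
    have h7 := le_mul ω (t + N + k) N
    have h8 := le_mul ρ s N
    have h9 := le_mul ρ (s + N + k) N
    linarith

end Subshift

/-! ### Conditions (β) and (γ), and uniformity. -/

theorem tendsto_div_of_forall_bounds {g : ℕ → ℝ} {L : ℝ}
    (hup : ∀ ε > 0, ∃ D, ∀ n : ℕ, g n ≤ (L + ε) * n + D)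
    (hlow : ∀ ε > 0, ∃ D, ∀ n : ℕ, (L - ε) * n - D ≤ g n) :
    Tendsto (fun n : ℕ => g n / n) atTop (𝓝 L) := by
  rw [tendsto_order]
  constructor
  · intro b hb
    obtain ⟨D, hD⟩ := hlow ((L - b) / 2) (by linarith)
    have h := (tendsto_const_div_atTop_nhds_zero_nat D).eventually_lt_const
      (show 0 < (L - b) / 2 by linarith)
    filter_upwards [h, eventually_gt_atTop 0] with n hn h0
    have h0' : (0 : ℝ) < n := by exact_mod_cast h0
    rw [div_lt_iff₀ h0'] at hn
    rw [lt_div_iff₀ h0']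
    have := hD n
    linarith
  · intro b hb
    obtain ⟨D, hD⟩ := hup ((b - L) / 2) (by linarith)
    have h := (tendsto_const_div_atTop_nhds_zero_nat D).eventually_lt_const
      (show 0 < (b - L) / 2 by linarith)
    filter_upwards [h, eventually_gt_atTop 0] with n hn h0
    have h0' : (0 : ℝ) < n := by exact_mod_cast h0
    rw [div_lt_iff₀ h0'] at hn
    rw [div_lt_iff₀ h0']
    have := hD n
    linarith

theorem tendsto_int_atTop_iff {f : ℤ → ℝ} {l : Filter ℝ} :
    Tendsto f atTop l ↔ Tendsto (fun n : ℕ => f n) atTop l := by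
  rw [← Nat.map_cast_int_atTop, tendsto_map'_iff]
  rfl

theorem tendsto_int_atBot_iff {f : ℤ → ℝ} {l : Filter ℝ} :
    Tendsto f atBot l ↔ Tendsto (fun n : ℕ => f (-n)) atTop l := by
  rw [← Filter.map_neg_atTop, tendsto_map'_iff]
  exact tendsto_int_atTop_iff

namespace ToeplitzCoding

variable {A : Type*} [Finite A] [TopologicalSpace A] [DiscreteTopology A] (c : ToeplitzCoding A)

open Subshift

/-- Growth of a locally constant cocycle over a simple Toeplitz subshift: uniform upper bounds, and
along the leading sequences the products of the two half-line cocycles grow at the full rate. -/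
theorem exists_growth {M : c.subshift.carrier → SL2} (hM : c.subshift.IsLocConst M) :
    ∃ L : ℝ, 0 ≤ L ∧
      (∀ ε > 0, ∃ D, ∀ ω (n : ℕ),
        Real.log ‖slToCLM (cocycleForward c.subshift.T M n ω)‖ ≤ (L + ε) * n + D) ∧
      (∀ x, HasGrowthRate (fun l => cocycleForward c.subshift.T M l (c.leadingPoint x)) L) ∧
      (∀ x, HasGrowthRate (fun l => cocycleBackward c.subshift.T M l (c.leadingPoint x)) L) ∧
      (0 < L → ∀ x, ∃ᶠ l : ℕ in atTop, 7 / 4 * L * l ≤ Real.log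
        ‖slToCLM (cocycleForward c.subshift.T M l (c.leadingPoint x) *
          (cocycleBackward c.subshift.T M l (c.leadingPoint x))⁻¹)‖) := by
  obtain ⟨K, C, hMK, hG⟩ := exists_isWordCost hM
  have hK := hG.K_nonneg
  have hC := hG.C_nonneg
  obtain ⟨L, hL, hup, hfor, hback⟩ := hG.exists_rate
  have hFG : ∀ ω (n : ℕ), Real.log ‖slToCLM (cocycleForward c.subshift.T M n ω)‖ =
      logNorm M ω 0 n := fun ω n => by
    rw [logNorm, zpow_zero, Equiv.Perm.one_apply]
  have hBG : ∀ ω (n : ℕ), Real.log ‖slToCLM (cocycleBackward c.subshift.T M n ω)‖ =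
      logNorm M ω (-n) n := fun ω n => by
    rw [logNorm, cocycleBackward_eq, log_norm_slToCLM_inv]
  have hMexp : ∀ ω, ‖slToCLM (M ω)‖ ≤ Real.exp K := fun ω =>
    (Real.log_le_iff_le_exp (norm_slToCLM_pos _)).1 (hMK ω)
  refine ⟨L, hL, fun ε hε => ?_, fun x => ⟨⟨Real.exp K, fun l => ?_⟩, ?_⟩,
    fun x => ⟨⟨Real.exp K, fun l => ?_⟩, ?_⟩, fun hL0 x => ?_⟩
  · obtain ⟨D, hD⟩ := hup ε hε
    exact ⟨D, fun ω n => by rw [hFG]; exact hD _ _ _⟩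
  · rw [cocycleForward, mul_inv_cancel_right]
    exact hMexp _
  · refine tendsto_div_of_forall_bounds (fun ε hε => ?_) (fun ε hε => ?_)
    · obtain ⟨D, hD⟩ := hup ε hε
      exact ⟨D, fun n => by rw [hFG]; exact hD _ _ _⟩
    · obtain ⟨D, hD⟩ := hfor ε hε
      -- The lower bound is for words starting at `1`; moving the start to the origin changes one
      -- letter at each end.
      refine ⟨D + 2 * K, fun n => ?_⟩
      rw [hFG]
      have h1 := hG.right_le (c.leadingPoint x) 0 1 n
      have h2 := hG.add_le (c.leadingPoint x) 0 n 1
      have h3 := hG.le_mul (c.leadingPoint x) 0 1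
      have h4 := hG.le_mul (c.leadingPoint x) (0 + n) 1
      have h5 := hD x n
      simp only [zero_add, Nat.cast_one, mul_one] at h1 h2 h3 h4
      rw [add_comm 1 n] at h1
      linarith
  · rw [cocycleBackward, mul_inv_cancel_right, norm_slToCLM_inv]
    exact hMexp _
  · refine tendsto_div_of_forall_bounds (fun ε hε => ?_) (fun ε hε => ?_)
    · obtain ⟨D, hD⟩ := hup ε hε
      exact ⟨D, fun n => by rw [hBG]; exact hD _ _ _⟩
    · obtain ⟨D, hD⟩ := hback ε hε
      exact ⟨D, fun n => by rw [hBG]; exact hD _ _⟩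
  -- When `a_k = x`, the window from `-P + 1` to `P - 1` is the prefix of length `2P - 1`. As `15/16
  -- * 2 - 7/4 = 1/8`, a term `L * P / 8` is left for the constants, hence the factor `8 / L`.
  · obtain ⟨D, hD⟩ := hfor (L / 16) (by linarith)
    have hlarge := c.tendsto_period.eventually_ge_atTop
      (8 / L * (D + C + K + (L - L / 16)))
    refine c.period_strictMono.tendsto_atTop.frequently
      ((x.2.and_eventually hlarge).mono fun k hk => ?_)
    obtain ⟨hk, hk2⟩ := hk
    rw [div_mul_eq_mul_div, div_le_iff₀ hL0] at hk2
    set P := c.period k with hP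
    have hP0 : 0 < P := c.period_pos k
    rw [cocycleForward_mul_inv]
    change _ ≤ logNorm M (c.leadingPoint x) (-P) (P + P)
    have h1 := hD x (2 * P - 1)
    have h2 := hG.congr (c.leadingPoint x) (c.leadingPoint x) 1 (-P + (1 : ℕ)) (2 * P - 1)
      fun i hi => by
        have h3 := c.leadingSeq_eq_of_abs_lt k (t := -P + (1 : ℕ) + i)
          (by rw [abs_lt]; omega)
        rw [hk] at h3
        refine Eq.trans ?_ h3.symm
        rw [← hP, show (P : ℤ) + (-P + (1 : ℕ) + i) = 1 + i by push_cast; ring]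
        exact c.leadingSeq_of_ne _ (by omega)
    have h3 := hG.right_le (c.leadingPoint x) (-P) 1 (2 * P - 1)
    have h4 := hG.le_mul (c.leadingPoint x) (-P) 1
    rw [show 1 + (2 * P - 1) = P + P by omega] at h3
    rw [Nat.cast_sub (by omega)] at h1
    push_cast at h1 h4
    linarith

theorem leadingBeta_leadingGamma {M : c.subshift.carrier → SL2} (hM : c.subshift.IsLocConst M)
    {r : ℕ} (x : Fin r → {x : A | ∃ᶠ k in atTop, c.a k = x}) :
    c.subshift.LeadingBeta (fun j => c.leadingPoint (x j)) M ∧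
      c.subshift.LeadingGamma (fun j => c.leadingPoint (x j)) M := by
  obtain ⟨L, hL, -, hX, hY, hXY⟩ := c.exists_growth hM
  simp only [LeadingBeta, LeadingGamma, tendsto_int_atTop_iff, tendsto_int_atBot_iff,
    cocycle_natCast, cocycle_neg_natCast, Int.cast_neg, Int.cast_natCast, abs_neg, Nat.abs_cast]
  refine ⟨⟨L, fun j => ⟨(hX (x j)).tendsto, (hY (x j)).tendsto⟩⟩, fun j v hv => ?_⟩
  rcases hL.eq_or_lt with rfl | hL
  -- At rate zero, `log ‖Z l v‖` differs from `log ‖v‖` by at most `log ‖Z l‖`, so both limits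
  -- vanish.
  · have key : ∀ {Z : ℕ → SL2}, HasGrowthRate Z 0 →
        Tendsto (fun l : ℕ => Real.log ‖slToCLM (Z l) v‖ / l) atTop (𝓝 0) := by
      intro Z hZ
      have h1 : Tendsto (fun l : ℕ => (Real.log ‖slToCLM (Z l) v‖ - Real.log ‖v‖) / l) atTop
          (𝓝 0) := by
        refine squeeze_zero_norm (fun l => ?_) hZ.tendsto
        rw [Real.norm_eq_abs, abs_div, Nat.abs_cast]
        exact div_le_div_of_nonneg_right (abs_log_norm_apply_sub_le _ hv) (Nat.cast_nonneg l)
      have h2 := h1.add (tendsto_const_div_atTop_nhds_zero_nat (Real.log ‖v‖))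
      rw [add_zero] at h2
      refine h2.congr fun l => ?_
      rw [← add_div, sub_add_cancel]
    exact ⟨0, 0, key (hX _), key (hY _), fun h => lt_irrefl _ h.1⟩
  · exact (hX (x j)).exists_tendsto_apply (hY (x j)) hL (hXY hL (x j)) hv

theorem subshift_LSC : c.subshift.LSC := by
  obtain ⟨r, ⟨e⟩⟩ := Finite.exists_equiv_fin {x : A | ∃ᶠ k in atTop, c.a k = x}
  refine ⟨r, ?_, _, c.leadingAlpha e.symm, fun M hM => c.leadingBeta_leadingGamma hM _⟩
  obtain ⟨x, hx⟩ := c.eventual_nontrivial.nonempty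
  have := (e ⟨x, hx⟩).2
  omega

theorem isUniformCocycle {M : c.subshift.carrier → SL2} (hM : c.subshift.IsLocConst M) :
    IsUniformCocycle c.subshift.T M := by
  obtain ⟨K, C, hMK, hG⟩ := exists_isWordCost hM
  obtain ⟨L, hL, hup, hX, hY, hXY⟩ := c.exists_growth hM
  have hlow : ∀ ε > 0, ∃ D, ∀ᶠ n : ℕ in atTop, ∀ ω,
      (L - ε) * n - D ≤ Real.log ‖slToCLM (cocycleForward c.subshift.T M n ω)‖ := by
    intro ε hε
    rcases hL.eq_or_lt with rfl | hL
    · refine ⟨0, Eventually.of_forall fun n ω => le_trans ?_ (log_norm_slToCLM_nonneg _)⟩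
      have : 0 ≤ ε * n := by positivity
      linarith
    · have hglue : ∀ x, ∃ D : ℝ, ∀ l m : ℕ, (L - ε) * (l + m) - D ≤ Real.log
          ‖slToCLM (cocycleForward c.subshift.T M l (c.leadingPoint x) *
            (cocycleBackward c.subshift.T M m (c.leadingPoint x))⁻¹)‖ := fun x => by
        refine (hX x).exists_log_mul_inv_ge (hY x) hL hG.K_nonneg (fun l => ?_) (fun l => ?_)
          (hXY hL x) hε
        · have := hG.le_mul (c.leadingPoint x) 0 l
          rwa [logNorm, zpow_zero, Equiv.Perm.one_apply] at this
        · rw [cocycleBackward_eq, log_norm_slToCLM_inv]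
          exact hG.le_mul (c.leadingPoint x) (-l) l
      choose D hD using hglue
      obtain ⟨D₀, hD₀⟩ := (Set.finite_range D).bddAbove
      -- A long word is read as a window around the origin of a leading sequence; finitely many
      -- leading points give a common constant, and `C` pays for changing the point.
      refine ⟨D₀ + C, c.eventually_exists_leadingPoint.mono fun n hn ω => ?_⟩
      obtain ⟨x, k, hk, h⟩ := hn ω 0
      have h1 := hG.congr (c.leadingPoint x) ω (-k) 0 n fun i hi => (h i hi).symm
      have h2 := hD x (n - k) k
      rw [cocycleForward_mul_inv, Nat.cast_sub hk.le, sub_add_cancel,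
        show k + (n - k) = n by omega] at h2
      have h3 := hD₀ ⟨x, rfl⟩
      have h4 : logNorm M ω 0 n = Real.log ‖slToCLM (cocycleForward c.subshift.T M n ω)‖ := by
        rw [logNorm, zpow_zero, Equiv.Perm.one_apply]
      change _ ≤ logNorm M (c.leadingPoint x) (-k) n at h2
      linarith
  refine ⟨L, ?_⟩
  rw [Metric.tendstoUniformly_iff]
  intro ε hε
  obtain ⟨D, hD⟩ := hup (ε / 2) (by linarith)
  obtain ⟨D', hD'⟩ := hlow (ε / 2) (by linarith)
  filter_upwards [hD', eventually_gt_atTop 0,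
    (tendsto_const_div_atTop_nhds_zero_nat D).eventually_lt_const (half_pos hε),
    (tendsto_const_div_atTop_nhds_zero_nat D').eventually_lt_const (half_pos hε)]
    with n h1 h0 h2 h3 ω
  have h0' : (0 : ℝ) < n := by exact_mod_cast h0
  have h4 := h1 ω
  have h5 := hD ω n
  rw [div_lt_iff₀ h0'] at h2 h3
  rw [cocycle_natCast, dist_comm, Real.dist_eq, abs_sub_lt_iff, sub_lt_iff_lt_add,
    sub_lt_comm, div_lt_iff₀ h0', lt_div_iff₀ h0']
  constructor <;> linarith

end ToeplitzCoding

/-! ## A simple Toeplitz subshift without the Boshernitzan condition -/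

namespace ToeplitzCoding

/-- Recognizability: a position where the letter of a later hole is followed by the block of
length `period k - 1` is a hole of the `k`-th skeleton. -/
theorem period_dvd_of_window {A : Type*} (c : ToeplitzCoding A) {k : ℕ} {q : ℤ}
    (h : ∀ s : ℤ, 0 < s → s < c.period k → c.a (c.level (q + s)) = c.a (c.level s))
    (hk : ∀ j, j + 1 = k → c.a (c.level q) ≠ c.a j) : (c.period k : ℤ) ∣ q := by
  have key : ∀ j ≤ k, (c.period j : ℤ) ∣ q := by
    intro j
    induction j with
    | zero => simp [period]
    | succ j ih =>
      intro hj
      by_contra hn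
      have hlev := c.level_eq (ih (by omega)) hn
      rcases hj.eq_or_lt with hj | hj
      · exact hk j hj (by rw [hlev])
      -- At the offset `period (j + 1)` the window demands `a_{j+1}`, while a position `q` of level
      -- `j` would produce `a_j` there. For `j + 1 = k` this offset lies outside the window, and the
      -- letter at `q` itself decides.
      · have h1 := h (c.period (j + 1)) (by exact_mod_cast c.period_pos _)
          (by exact_mod_cast c.period_strictMono hj)
        rw [c.level_congr (t := q) hn (by simp), hlev, level_period] at h1
        exact c.a_succ_ne j h1.symm
  exact key k le_rfl

/-- The coding with `a_k = k mod 4` and `n_k = k + 2`. -/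
def cyclicCoding : ToeplitzCoding (Fin 4) where
  a k := Fin.ofNat 4 k
  n k := k + 2
  two_le_n k := by omega
  a_succ_ne k h := by
    have := congrArg Fin.val h
    simp only [Fin.ofNat] at this
    omega
  eventual_nontrivial := by
    refine ⟨0, ?_, 1, ?_, by decide⟩ <;>
    refine frequently_atTop.2 fun N => ?_
    · exact ⟨4 * N, by omega, Fin.ext (by simp [Fin.ofNat])⟩
    · exact ⟨4 * N + 1, by omega, Fin.ext (by simp [Fin.ofNat])⟩

theorem cyclicCoding_a_eq_iff {i j : ℕ} :
    cyclicCoding.a i = cyclicCoding.a j ↔ i % 4 = j % 4 := by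
  simp [cyclicCoding, Fin.ofNat, Fin.ext_iff]

/-- The letter `a_{k+2}` followed by the block of length `period k - 1` only occurs at multiples of
`period (k + 2)`. -/
theorem cyclicCoding_dvd {k n : ℕ} (hn : cyclicCoding.period k ≤ n) {q : ℤ} (hq : q ≠ 0)
    (h : ∀ i < n, cyclicCoding.a (cyclicCoding.level (q + (i : ℕ))) =
      cyclicCoding.a (cyclicCoding.level (cyclicCoding.period (k + 2) + (i : ℕ)))) :
    (cyclicCoding.period (k + 2) : ℤ) ∣ q := by
  have hP := cyclicCoding.period_pos k
  have h0 := h 0 (by omega)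
  rw [Nat.cast_zero, add_zero, add_zero, level_period] at h0
  have hd : (cyclicCoding.period k : ℤ) ∣ q := by
    refine cyclicCoding.period_dvd_of_window (fun s hs hs' => ?_) fun j hj => ?_
    · have h1 := h s.toNat (by omega)
      rw [Int.toNat_of_nonneg hs.le] at h1
      rw [h1, cyclicCoding.level_congr (k := k) (t := s)]
      · apply cyclicCoding.not_period_dvd_of_abs_lt hs.ne'
        rwa [abs_of_pos hs]
      · rw [add_sub_cancel_right]
        exact cyclicCoding.period_dvd_int (by omega)
    -- Here `j = k - 1`, and `k + 2` and `k - 1` differ by three: four letters are needed to tell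
    -- them apart.
    · rw [h0, Ne, cyclicCoding_a_eq_iff]
      omega
  rw [cyclicCoding_a_eq_iff] at h0
  have h1 := (cyclicCoding.le_level_iff hq).2 hd
  -- The level is at least `k` and congruent to `k + 2` modulo four, which excludes `k` and `k + 1`.
  exact (cyclicCoding.le_level_iff hq).1 (by omega)

theorem iterate_T_apply {A : Type*} [TopologicalSpace A] (Ω : Subshift A) (m : ℕ) (ω : Ω.carrier)
    (i : ℤ) : (Ω.T^[m] ω).1 i = ω.1 (i + m) := by
  rw [← Ω.T_zpow_apply, zpow_natCast, Equiv.Perm.coe_pow]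

theorem measurableSet_cylinder {A : Type*} [TopologicalSpace A] [MeasurableSpace A]
    [MeasurableSingletonClass A] (Ω : Subshift A) (ρ : ℤ → A) (l : ℤ) (n : ℕ) :
    MeasurableSet {ω : Ω.carrier | wordAt ω.1 0 n = wordAt ρ l n} := by
  simp only [wordAt_eq_iff, Set.ofPred_forall]
  refine MeasurableSet.iInter fun i => MeasurableSet.iInter fun _ => ?_
  exact ((measurable_pi_apply _).comp measurable_subtype_coe) (measurableSet_singleton _)

theorem not_boshernitzan_cyclicCoding : ¬ cyclicCoding.subshift.Boshernitzan := by
  rintro ⟨μ, hμ, herg, hlim⟩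
  obtain ⟨x, hx⟩ := cyclicCoding.eventual_nontrivial.nonempty
  set ρ := cyclicCoding.leadingPoint ⟨x, hx⟩
  have key : ∀ K n : ℕ, cyclicCoding.period K ≤ n →
      (n : ℝ≥0∞) * (⨅ w ∈ cyclicCoding.subshift.words n,
        μ {ω : cyclicCoding.subshift.carrier | wordAt ω.1 0 n = w}) ≤ (K : ℝ≥0∞)⁻¹ := by
    intro K n hKn
    obtain ⟨k, hk, m, hm1, hm, hle, hlt⟩ := cyclicCoding.exists_period_le hKn
    have hkn : cyclicCoding.period k ≤ n :=
      le_trans (Nat.le_mul_of_pos_right _ hm1) hle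
    set d := cyclicCoding.period (k + 2) with hd
    set S := {ω : cyclicCoding.subshift.carrier | wordAt ω.1 0 n = wordAt ρ.1 d n} with hS
    have hword : ∀ i : ℕ, ρ.1 (d + (i : ℕ)) = cyclicCoding.a (cyclicCoding.level (d + (i : ℕ))) :=
      fun i => cyclicCoding.leadingSeq_of_ne _ (by have := cyclicCoding.period_pos (k + 2); omega)
    -- Two visits to the cylinder less than `d` apart are impossible, so its first `d` preimages are
    -- disjoint and of equal measure.
    have hμS : (d : ℝ≥0∞) * μ S ≤ 1 := by
      by_contra! h
      rw [← MeasureTheory.measure_univ (μ := μ)] at h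
      obtain ⟨ω, hω, r, ⟨hr0, hrd⟩, hωr⟩ :=
        herg.toMeasurePreserving.exists_mem_iterate_mem_of_measure_univ_lt_mul_measure
          (measurableSet_cylinder _ _ _ _).nullMeasurableSet h
      replace hω := wordAt_eq_iff.1 (show wordAt ω.1 0 n = _ from hω)
      replace hωr := wordAt_eq_iff.1
        (show wordAt (cyclicCoding.subshift.T^[r] ω).1 0 n = _ from hωr)
      obtain ⟨b, hb⟩ := (cyclicCoding.mem_toeplitzSet_iff ω.1).1 ω.2 0 (r + n)
      have h1 : (d : ℤ) ∣ b + 1 := cyclicCoding_dvd hkn (by omega) fun i hi => by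
        rw [← hword, ← hω i hi, hb i (by omega)]
      have h2 : (d : ℤ) ∣ b + 1 + r := cyclicCoding_dvd hkn (by omega) fun i hi => by
        have h3 := hb (r + i) (by omega)
        rw [← hword, ← hωr i hi, iterate_T_apply, zero_add]
        rw [zero_add, Nat.cast_add, ← add_assoc] at h3
        rw [← h3, add_comm (r : ℤ)]
      have h3 : (d : ℤ) ∣ r := (dvd_add_right h1).1 h2
      have := Int.le_of_dvd (by omega) h3
      omega
    -- The unbounded `n_k` enter here: `n` is at most `period (k + 1)`, and `d` is larger than that
    -- period by the factor `n_{k+1} = k + 3`.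
    have hdn : n * K ≤ d := by
      have h1 : n ≤ cyclicCoding.period (k + 1) := by
        rw [period_succ]
        exact hlt.le.trans (Nat.mul_le_mul_left _ hm)
      rw [hd, period_succ _ (k + 1)]
      exact Nat.mul_le_mul h1 (show K ≤ k + 1 + 2 by omega)
    rw [ENNReal.le_inv_iff_mul_le]
    calc _ ≤ (n : ℝ≥0∞) * μ S * K := by
          gcongr
          exact iInf₂_le _ ⟨ρ.1, ρ.2, d, rfl⟩
      _ = ((n * K : ℕ) : ℝ≥0∞) * μ S := by push_cast; ring
      _ ≤ d * μ S := by gcongr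
      _ ≤ 1 := hμS
  obtain ⟨K, hK⟩ := ENNReal.exists_inv_nat_lt hlim.ne'
  refine absurd hK (not_lt.2 (limsup_le_of_le (by isBoundedDefault) ?_))
  filter_upwards [eventually_ge_atTop (cyclicCoding.period K)] with n hn using key K n hn

end ToeplitzCoding

theorem mainTheorem2 :
    (∀ (A : Type*) [Finite A] [TopologicalSpace A] [DiscreteTopology A] (c : ToeplitzCoding A),
      c.subshift.LSC ∧
      ∀ M : c.subshift.carrier → Matrix.SpecialLinearGroup (Fin 2) ℝ,
        c.subshift.IsLocConst M → IsUniformCocycle c.subshift.T M) ∧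
    (∃ (m : ℕ) (c : ToeplitzCoding (Fin m)),
      ¬ c.subshift.Boshernitzan ∧
      ∀ M : c.subshift.carrier → Matrix.SpecialLinearGroup (Fin 2) ℝ,
        c.subshift.IsLocConst M → IsUniformCocycle c.subshift.T M) :=
  ⟨fun _ _ _ _ c => ⟨c.subshift_LSC, fun _ hM => c.isUniformCocycle hM⟩,
    4, ToeplitzCoding.cyclicCoding, ToeplitzCoding.not_boshernitzan_cyclicCoding,
    fun _ hM => ToeplitzCoding.isUniformCocycle _ hM⟩
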